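/- Let $\nu(s)=\zeta(s)\zeta''(s)-\zeta'(s)^2$, where $\zeta$ is the Riemann zeta function, and let $\phi(s)=(1-2^{1-s})^4\,\nu(s)$. For $n\ge 1$ put $$a(n)=\sum_{d\mid n}\bigl(\log(d)^2-\log(d)\log(n/d)\bigr),\qquad b(n)=\sum_{\substack{0\le m\le 4\\ 2^m\mid n}}\binom4m(-2)^m\,a(n/2^m),\qquad B(x)=\sum_{n\le x}b(n).$$ Then: 1. for $\mathrm{Re}(s)>1$ the Dirichlet series $\sum_{n\ge1}b(n)n^{-s}$ converges absolutely and $\phi(s)=\sum_{n\ge 1}b(n)n^{-s}$; 2. for every $\varepsilon>0$, $B(x)=O_\varepsilon\bigl(x^{1/3+\varepsilon}\bigr)$ as $x\to\infty$; 3. the abscissa of (ordinary, possibly conditional) convergence $\sigma_c$ of the Dirichlet series $\sum_{n\ge1}b(n)n^{-s}$ of $\phi$ satisfies $\sigma_c\le 1/3$; here $\sigma_c\in[-\infty,\infty]$ is the infimum of all $\sigma$ such that the series converges at every $s$ with $\mathrm{Re}(s)>\sigma$. -/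

import Mathlib

open Filter Topology Asymptotics

noncomputable section

namespace ZetaLog

/-- `ν(s) = ζ(s) ζ''(s) - ζ'(s)²`. -/
def nu (s : ℂ) : ℂ :=
  riemannZeta s * iteratedDeriv 2 riemannZeta s - (deriv riemannZeta s) ^ 2

/-- `φ(s) = (1 - 2^{1-s})⁴ ν(s)`. -/
def phi (s : ℂ) : ℂ :=
  (1 - (2 : ℂ) ^ (1 - s)) ^ 4 * nu s

/-- The Dirichlet coefficients of `ν`:
`a(n) = ∑_{d ∣ n} (log(d)² - log(d) log(n/d))`. The quotient `n / d` is exact. -/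
def a (n : ℕ) : ℝ :=
  ∑ d ∈ n.divisors, (Real.log d ^ 2 - Real.log d * Real.log ((n / d : ℕ) : ℝ))

/-- The Dirichlet coefficients of `φ`:
`b(n) = ∑_{0 ≤ m ≤ 4, 2^m ∣ n} (4 choose m) (-2)^m a(n / 2^m)`. -/
def b (n : ℕ) : ℝ :=
  ∑ m ∈ Finset.range 5,
    if 2 ^ m ∣ n then (Nat.choose 4 m : ℝ) * (-2) ^ m * a (n / 2 ^ m) else 0

/-- The summatory function `B(x) = ∑_{n ≤ x} b(n)`. -/
def B (x : ℝ) : ℝ :=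
  ∑ n ∈ Finset.Icc 1 ⌊x⌋₊, b n

/-- Ordinary (possibly conditional) convergence of the Dirichlet series `∑_{n ≥ 1} f(n) n^{-s}`:
its partial sums have a limit. -/
def DirichletConverges (f : ℕ → ℂ) (s : ℂ) : Prop :=
  ∃ l : ℂ, Tendsto (fun N : ℕ => ∑ n ∈ Finset.Icc 1 N, f n * (n : ℂ) ^ (-s)) atTop (𝓝 l)

/-- The abscissa of (ordinary) convergence `σ_c`: the infimum, in `[-∞, ∞]`, of all `σ` such that
the Dirichlet series converges at every `s` with `Re s > σ`. -/
def abscissaOfConv (f : ℕ → ℂ) : EReal :=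
  sInf {σ : EReal | ∀ s : ℂ, σ < (s.re : EReal) → DirichletConverges f s}

end ZetaLog

end

/-!
The point is that `φ` is a polynomial in `2^{-s}` and the alternating zeta function `η = γ ζ`,
`γ(s) = 1 - 2^{1-s}`, and its derivatives. Since `(log η)'' = (log γ)'' + (log ζ)''` and
`γ γ'' - γ'² = -2 log²2 · 2^{-s}`, one has
`φ = γ² (η η'' - η'²) + 2 log²2 · 2^{-s} η²`
(`gammaAF_pow_mul_zetaWronskian`, proved in the ring of arithmetic functions with the derivation
`f ↦ f · log`). So it is enough to bound the summatory functions of the coefficients of `η²` and of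
`η η'' - η'²` by `O(N^{1/3+ε})`; no main terms occur.

With `χ(n) = (-1)^{n+1}`, the coefficient of `η η'' - η'²` at `n`, symmetrised, is
`½ ∑_{de=n} χ(d) χ(e) log²(e/d)`. Its summand vanishes to second order on the diagonal, so after the
hyperbola method the inner sum over `d < e ≤ N/d` is `½ χ(⌊N/d⌋) log²(⌊N/d⌋/d)` up to
`O(log N / d)` (`abs_sum_chi_mul_log_sq_sub_le`). For `η²` the corresponding identity is exact
(`sum_eta_mul_eta`). The weights being monotone in `d`, everything reduces to
`∑_{d ≤ D} χ(d) χ(⌊N/d⌋)` with `D ≤ √N`. The parity of `⌊x⌋` is a combination of the sawtooth `ψ` at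
`x` and `x/2`, and what is needed is Voronoi's bound `∑_{d ≤ D} ψ(y/d) ≪ y^{1/3+ε}`
(`exists_abs_sum_sawtooth_le`).

That bound is obtained on dyadic blocks. As `ψ` has slope `1` and jumps down only, it lies, up to
`δ`, between difference quotients `(Ψ(y ± δ) - Ψ(y)) / (± δ)` of its antiderivative `Ψ = B₂ / 2`,
whose Fourier series converges absolutely (`abs_sum_sawtooth_le`). The exponential sums
`∑ e(ky/n)` that arise are estimated by a second derivative test for second differences
(`norm_sum_e_le_of_second_differences`), which rests on the Kusmin–Landau inequality
(`norm_sum_e_le_of_increments`).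

The abscissa of convergence follows from the bound for `B` by summation by parts.
-/

namespace ZetaLog

/-! ### Exponential sums with increasing differences -/

/-- The additive character `e(t) = exp(2πit)` of `ℝ / ℤ`. -/
noncomputable def e (t : ℝ) : ℂ := Complex.exp ((2 * Real.pi * t : ℝ) * Complex.I)

lemma norm_e (t : ℝ) : ‖e t‖ = 1 := Complex.norm_exp_ofReal_mul_I _

lemma e_add (s t : ℝ) : e (s + t) = e s * e t := by
  rw [e, e, e, ← Complex.exp_add]; congr 1; push_cast; ring

lemma e_intCast (m : ℤ) : e m = 1 := by
  rw [e, Complex.exp_eq_one_iff]; exact ⟨m, by push_cast; ring⟩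

lemma e_re (t : ℝ) : (e t).re = Real.cos (2 * Real.pi * t) := by
  rw [e, Complex.exp_ofReal_mul_I_re]

/-- The identity `1 / (e(t) - 1) = -1/2 - (i/2) cot(πt)`. -/
lemma e_sub_one_mul (t : ℝ) (h : Real.sin (Real.pi * t) ≠ 0) :
    (e t - 1) * (-1 / 2 - Complex.I *
      ((1 / 2 * (Real.cos (Real.pi * t) / Real.sin (Real.pi * t)) : ℝ) : ℂ)) = 1 := by
  have h1 : e t =
      ((Real.cos (Real.pi * t) : ℝ) + (Real.sin (Real.pi * t) : ℝ) * Complex.I) ^ 2 := by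
    have : e t = Complex.exp ((Real.pi * t : ℝ) * Complex.I) ^ 2 := by
      rw [e, ← Complex.exp_nat_mul]; congr 1; push_cast; ring
    rw [this, Complex.exp_mul_I, Complex.ofReal_cos, Complex.ofReal_sin]
  have h2 := Real.sin_sq_add_cos_sq (Real.pi * t)
  rw [h1]
  set s := Real.sin (Real.pi * t)
  set c := Real.cos (Real.pi * t)
  have hs : (s : ℂ) ≠ 0 := by exact_mod_cast h
  have h3 : (s : ℂ) ^ 2 + (c : ℂ) ^ 2 = 1 := by exact_mod_cast h2
  push_cast
  field_simp
  linear_combination (s - c * Complex.I) * h3 +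
    (-c * s ^ 2 * Complex.I - 2 * c ^ 2 * s - s ^ 3) * Complex.I_sq

lemma two_mul_le_sin_pi_mul {δ t : ℝ} (hδ : 0 ≤ δ) (h1 : δ ≤ t) (h2 : t ≤ 1 - δ) :
    2 * δ ≤ Real.sin (Real.pi * t) := by
  have hp := Real.pi_pos
  rcases le_total t (1 / 2) with h | h
  · have := Real.mul_le_sin (x := Real.pi * t) (by nlinarith) (by nlinarith)
    have e1 : 2 / Real.pi * (Real.pi * t) = 2 * t := by field_simp
    linarith
  · have := Real.mul_le_sin (x := Real.pi * (1 - t)) (by nlinarith) (by nlinarith)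
    have e1 : 2 / Real.pi * (Real.pi * (1 - t)) = 2 * (1 - t) := by field_simp
    have e2 : Real.sin (Real.pi * (1 - t)) = Real.sin (Real.pi * t) := by
      rw [mul_sub, mul_one, Real.sin_pi_sub]
    linarith

/-- The cotangent `cot(πt)` is antitone on `(0, 1)`. -/
lemma cot_antitone {s t : ℝ} (hs : 0 < s) (hst : s ≤ t) (ht : t < 1) :
    Real.cos (Real.pi * t) / Real.sin (Real.pi * t) ≤
      Real.cos (Real.pi * s) / Real.sin (Real.pi * s) := by
  have hp := Real.pi_pos
  have h1 : 0 < Real.sin (Real.pi * s) :=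
    Real.sin_pos_of_pos_of_lt_pi (by positivity) (by nlinarith)
  have h2 : 0 < Real.sin (Real.pi * t) :=
    Real.sin_pos_of_pos_of_lt_pi (mul_pos hp (by linarith)) (by nlinarith)
  rw [div_le_div_iff₀ h2 h1]
  have := Real.sin_nonneg_of_nonneg_of_le_pi (x := Real.pi * t - Real.pi * s)
    (by nlinarith) (by nlinarith)
  rw [Real.sin_sub] at this
  linarith

/-- The norm of `1 / (e(t) - 1)` is at most `1 / (4δ)` when `t` is `δ`-far from the integers. -/
lemma norm_kernel_le {δ t : ℝ} (hδ : 0 < δ) (h1 : δ ≤ t) (h2 : t ≤ 1 - δ) :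
    ‖(-1 / 2 - Complex.I *
      ((1 / 2 * (Real.cos (Real.pi * t) / Real.sin (Real.pi * t)) : ℝ) : ℂ))‖ ≤ 1 / (4 * δ) := by
  have hs := two_mul_le_sin_pi_mul hδ.le h1 h2
  have hsc := Real.sin_sq_add_cos_sq (Real.pi * t)
  set s := Real.sin (Real.pi * t)
  set c := Real.cos (Real.pi * t)
  have hs0 : 0 < s := by linarith
  have h : ‖(-1 / 2 - Complex.I * ((1 / 2 * (c / s) : ℝ) : ℂ))‖ = 1 / (2 * s) := by
    rw [← sq_eq_sq₀ (norm_nonneg _) (by positivity), ← Complex.normSq_eq_norm_sq,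
      Complex.normSq_apply]
    simp
    field_simp
    linarith
  rw [h]
  apply one_div_le_one_div_of_le <;> linarith

lemma abs_half_cot_le {δ t : ℝ} (hδ : 0 < δ) (h1 : δ ≤ t) (h2 : t ≤ 1 - δ) :
    |1 / 2 * (Real.cos (Real.pi * t) / Real.sin (Real.pi * t))| ≤ 1 / (4 * δ) := by
  have h := (Complex.abs_im_le_norm _).trans (norm_kernel_le hδ h1 h2)
  generalize 1 / 2 * (Real.cos (Real.pi * t) / Real.sin (Real.pi * t)) = r at h ⊢
  simpa using h

/-- Kusmin–Landau with increments in `[δ, 1 - δ]`: the terms are the differences of `e(f(n))` times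
`1 / (e(f(n+1) - f(n)) - 1)`, and this factor has monotone imaginary part, so summation by parts
leaves only boundary terms. -/
lemma norm_sum_e_le_of_increments_aux (f : ℕ → ℝ) {δ : ℝ} (hδ : 0 < δ) (A B : ℕ)
    (hg : ∀ n, A ≤ n → n < B → δ ≤ f (n + 1) - f n ∧ f (n + 1) - f n ≤ 1 - δ)
    (hmono : ∀ n, A ≤ n → n + 1 < B → f (n + 1) - f n ≤ f (n + 2) - f (n + 1)) :
    ‖∑ n ∈ Finset.Ico A B, e (f n)‖ ≤ 1 / δ := by
  set v : ℕ → ℝ := fun n => 1 / 2 * (Real.cos (Real.pi * (f (n + 1) - f n)) /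
    Real.sin (Real.pi * (f (n + 1) - f n))) with hv
  set w : ℕ → ℂ := fun n => -1 / 2 - Complex.I * (v n : ℂ) with hw
  have hew : ∀ n, A ≤ n → n < B → e (f n) = (e (f (n + 1)) - e (f n)) * w n := by
    intro n h1 h2
    have hh := hg n h1 h2
    have hs := two_mul_le_sin_pi_mul hδ.le hh.1 hh.2
    have := e_sub_one_mul (f (n + 1) - f n) (by linarith)
    have h3 : e (f (n + 1)) = e (f n) * e (f (n + 1) - f n) := by
      rw [← e_add]; congr 1; ring
    rw [h3]
    calc e (f n) = e (f n) * ((e (f (n + 1) - f n) - 1) * w n) := by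
          rw [hw, hv]; simp only [this, mul_one]
      _ = _ := by ring
  have key : ∀ k, A + k < B → ‖∑ n ∈ Finset.Ico A (A + k + 1), e (f n)
      - e (f (A + k + 1)) * w (A + k) + e (f A) * w A‖ ≤ v A - v (A + k) := by
    intro k
    induction k with
    | zero =>
      intro h
      simp only [add_zero, Nat.Ico_succ_singleton, Finset.sum_singleton, sub_self]
      rw [norm_le_zero_iff]
      linear_combination hew A le_rfl h
    | succ k ih =>
      intro h
      have ih := ih (by omega)
      have h1 := hew (A + k + 1) (by omega) (by omega)
      have h2 := hg (A + k + 1) (by omega) (by omega)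
      have h3 := hg (A + k) (by omega) (by omega)
      have h4 := hmono (A + k) (by omega) (by omega)
      have h5 : v (A + k + 1) ≤ v (A + k) := by
        have := cot_antitone (s := f (A + k + 1) - f (A + k))
          (t := f (A + k + 2) - f (A + k + 1)) (by linarith) h4 (by linarith [h2.2])
        simp only [hv]
        rw [show A + k + 1 + 1 = A + k + 2 by ring]
        linarith
      rw [show A + (k + 1) = A + k + 1 by ring, Finset.sum_Ico_succ_top (by omega)]
      have h6 : ∑ n ∈ Finset.Ico A (A + k + 1), e (f n) + e (f (A + k + 1))
          - e (f (A + k + 1 + 1)) * w (A + k + 1) + e (f A) * w A =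
          (∑ n ∈ Finset.Ico A (A + k + 1), e (f n)
      - e (f (A + k + 1)) * w (A + k) + e (f A) * w A)
        + e (f (A + k + 1)) * (Complex.I * ((v (A + k + 1) - v (A + k) : ℝ) : ℂ)) := by
        have h7 : w (A + k) = w (A + k + 1) + Complex.I * ((v (A + k + 1) - v (A + k) : ℝ) : ℂ) := by
          simp only [hw]; push_cast; ring
        rw [h7]
        linear_combination h1
      rw [h6]
      refine (norm_add_le _ _).trans ?_
      rw [norm_mul, norm_mul, norm_e, Complex.norm_I, Complex.norm_real, Real.norm_eq_abs,
        abs_of_nonpos (by linarith)]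
      linarith
  rcases le_or_gt B A with hAB | hAB
  · rw [Finset.Ico_eq_empty (by omega)]; simp; positivity
  obtain ⟨k, rfl⟩ : ∃ k, B = A + k + 1 := ⟨B - A - 1, by omega⟩
  have hk := key k (by omega)
  have a1 := hg A le_rfl (by omega)
  have a2 := hg (A + k) (by omega) (by omega)
  have b1 : ‖w A‖ ≤ 1 / (4 * δ) := norm_kernel_le hδ a1.1 a1.2
  have b2 : ‖w (A + k)‖ ≤ 1 / (4 * δ) := norm_kernel_le hδ a2.1 a2.2
  have b3 : |v A| ≤ 1 / (4 * δ) := abs_half_cot_le hδ a1.1 a1.2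
  have b4 : |v (A + k)| ≤ 1 / (4 * δ) := abs_half_cot_le hδ a2.1 a2.2
  have hS : ∑ n ∈ Finset.Ico A (A + k + 1), e (f n) = (∑ n ∈ Finset.Ico A (A + k + 1), e (f n)
      - e (f (A + k + 1)) * w (A + k) + e (f A) * w A) + e (f (A + k + 1)) * w (A + k)
      - e (f A) * w A := by ring
  rw [hS]
  refine (norm_sub_le _ _).trans ((add_le_add_left (norm_add_le _ _) _).trans ?_)
  rw [norm_mul, norm_mul, norm_e, norm_e, one_mul, one_mul]
  have c1 := (abs_le.1 b3).2
  have c2 := (abs_le.1 b4).1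
  have : 1 / δ = 4 * (1 / (4 * δ)) := by field_simp
  linarith

/-- The Kusmin–Landau inequality. -/
lemma norm_sum_e_le_of_increments (f : ℕ → ℝ) {δ : ℝ} (hδ : 0 < δ) (m : ℤ) (A B : ℕ)
    (hg : ∀ n, A ≤ n → n < B → m + δ ≤ f (n + 1) - f n ∧ f (n + 1) - f n ≤ m + 1 - δ)
    (hmono : ∀ n, A ≤ n → n + 1 < B → f (n + 1) - f n ≤ f (n + 2) - f (n + 1)) :
    ‖∑ n ∈ Finset.Ico A B, e (f n)‖ ≤ 1 / δ := by
  have h := norm_sum_e_le_of_increments_aux (fun n => f n - m * n) hδ A B ?_ ?_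
  · have : ∀ n, e (f n) = e (f n - m * n) := by
      intro n
      have : f n = (f n - m * n) + ((m * n : ℤ) : ℝ) := by push_cast; ring
      conv_lhs => rw [this, e_add, e_intCast, mul_one]
    simpa only [this] using h
  · intro n h1 h2
    have := hg n h1 h2
    push_cast
    constructor <;> linarith
  · intro n h1 h2
    have := hmono n h1 h2
    push_cast
    linarith

lemma exists_eq_Ico_of_ordConnected (s : Finset ℕ)
    (h : ∀ x ∈ s, ∀ y ∈ s, ∀ z, x ≤ z → z ≤ y → z ∈ s) : ∃ a b, s = Finset.Ico a b := by
  rcases s.eq_empty_or_nonempty with rfl | hs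
  · exact ⟨0, 0, by simp⟩
  · refine ⟨s.min' hs, s.max' hs + 1, ?_⟩
    ext z
    rw [Finset.mem_Ico, Nat.lt_succ_iff]
    exact ⟨fun hz => ⟨s.min'_le z hz, s.le_max' z hz⟩,
      fun hz => h _ (s.min'_mem hs) _ (s.max'_mem hs) z hz.1 hz.2⟩

/-- A function growing by at least `l` at each step takes few values in an interval of length
`δ`. -/
lemma card_le_of_steps (g : ℕ → ℝ) {l δ α : ℝ} (hl : 0 < l) (hδ : 0 ≤ δ) (A B : ℕ)
    (hg : ∀ n, A ≤ n → n + 1 < B → g n + l ≤ g (n + 1))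
    (s : Finset ℕ) (hs : s ⊆ Finset.Ico A B) (h : ∀ n ∈ s, α ≤ g n ∧ g n ≤ α + δ) :
    (s.card : ℝ) ≤ δ / l + 1 := by
  rcases s.eq_empty_or_nonempty with rfl | hne
  · simp; positivity
  have hstep : ∀ k n, A ≤ n → n + k < B → g n + k * l ≤ g (n + k) := by
    intro k
    induction k with
    | zero => intro n _ _; simp
    | succ k ih =>
      intro n h1 h2
      have := ih n h1 (by omega)
      have := hg (n + k) (by omega) (by omega)
      rw [show n + (k + 1) = n + k + 1 by ring]
      push_cast; linarith
  have m1 := s.min'_mem hne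
  have m2 := s.max'_mem hne
  have hle : s.min' hne ≤ s.max' hne := s.min'_le _ m2
  obtain ⟨k, hk⟩ := Nat.exists_eq_add_of_le hle
  have h1 := Finset.mem_Ico.1 (hs m1)
  have h2 := Finset.mem_Ico.1 (hs m2)
  have h3 := hstep k (s.min' hne) h1.1 (by omega)
  rw [← hk] at h3
  have h4 := (h _ m1).1
  have h5 := (h _ m2).2
  have h6 : s ⊆ Finset.Icc (s.min' hne) (s.max' hne) := fun z hz =>
    Finset.mem_Icc.2 ⟨s.min'_le z hz, s.le_max' z hz⟩
  have h7 := Finset.card_le_card h6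
  rw [Nat.card_Icc] at h7
  have h8 : s.card ≤ k + 1 := by omega
  have h9 : (s.card : ℝ) ≤ k + 1 := by exact_mod_cast h8
  have h10 : (k : ℝ) ≤ δ / l := by rw [le_div_iff₀ hl]; linarith
  linarith

/-- The second derivative test of van der Corput, for second differences: the integer parts of the
increments split the range into few intervals; on each, the increments within `√l` of an integer
are few, and the rest is handled by the Kusmin–Landau inequality. -/
theorem norm_sum_e_le_of_second_differences (f : ℕ → ℝ) {l K : ℝ} (hl : 0 < l) (A B : ℕ)
    (h : ∀ n, A ≤ n → n + 1 < B →
      l ≤ f (n + 2) - 2 * f (n + 1) + f n ∧ f (n + 2) - 2 * f (n + 1) + f n ≤ K * l)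
    (hK : 1 ≤ K) (hAB : A ≤ B) :
    ‖∑ n ∈ Finset.Ico A B, e (f n)‖ ≤ 5 * (K * (B - A) * √l + 2 / √l) := by
  have hsl : 0 < √l := Real.sqrt_pos.2 hl
  have hsq : √l * √l = l := Real.mul_self_sqrt hl.le
  have hBA : (0 : ℝ) ≤ B - A := by
    have : (A : ℝ) ≤ B := by exact_mod_cast hAB
    linarith
  rcases lt_or_ge 1 l with hl1 | hl1
  · have h1 : 1 ≤ √l := by nlinarith
    have h2 : ‖∑ n ∈ Finset.Ico A B, e (f n)‖ ≤ B - A := by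
      refine (norm_sum_le _ _).trans ?_
      simp only [norm_e, Finset.sum_const, Nat.card_Ico, nsmul_eq_mul, mul_one]
      rw [Nat.cast_sub hAB]
    have h3 : (B - A : ℝ) ≤ K * (B - A) * √l := by
      have : (B - A : ℝ) ≤ K * (B - A) := by nlinarith
      nlinarith
    have : 0 ≤ 2 / √l := by positivity
    nlinarith [mul_nonneg (mul_nonneg (by linarith : (0:ℝ) ≤ K) hBA) hsl.le]
  rcases hAB.eq_or_lt with rfl | hlt
  · simp; positivity
  set g : ℕ → ℝ := fun n => f (n + 1) - f n with hgdef
  have hg1 : ∀ n, A ≤ n → n + 1 < B → g n + l ≤ g (n + 1) := by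
    intro n h1 h2
    have := (h n h1 h2).1
    simp only [hgdef]
    rw [show n + 1 + 1 = n + 2 by ring]
    linarith
  have hg2 : ∀ k n, A ≤ n → n + k < B → g (n + k) ≤ g n + k * (K * l) := by
    intro k
    induction k with
    | zero => intro n _ _; simp
    | succ k ih =>
      intro n h1 h2
      have h3 := ih n h1 (by omega)
      have h4 := (h (n + k) (by omega) (by omega)).2
      simp only [hgdef] at h3 ⊢
      rw [show n + (k + 1) + 1 = n + k + 2 by ring, show n + (k + 1) = n + k + 1 by ring]
      push_cast
      linarith
  have hmono : ∀ k n, A ≤ n → n + k < B → g n ≤ g (n + k) := by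
    intro k
    induction k with
    | zero => intro n _ _; simp
    | succ k ih =>
      intro n h1 h2
      have h3 := ih n h1 (by omega)
      have h4 := hg1 (n + k) (by omega) (by omega)
      rw [show n + (k + 1) = n + k + 1 by ring]
      linarith
  have hmono' : ∀ x y, A ≤ x → x ≤ y → y < B → g x ≤ g y := by
    intro x y h1 h2 h3
    obtain ⟨k, rfl⟩ := Nat.exists_eq_add_of_le h2
    exact hmono k x h1 h3
  set I := Finset.Ico A B with hI
  set T := Finset.Icc ⌊g A⌋ ⌊g (B - 1)⌋ with hT
  have hmaps : ∀ n ∈ I, ⌊g n⌋ ∈ T := by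
    intro n hn
    rw [hI, Finset.mem_Ico] at hn
    exact Finset.mem_Icc.2 ⟨Int.floor_mono (hmono' _ _ le_rfl hn.1 hn.2),
      Int.floor_mono (hmono' _ _ hn.1 (by omega) (by omega))⟩
  have hfib : ∀ m ∈ T, ‖∑ n ∈ I with ⌊g n⌋ = m, e (f n)‖ ≤ 5 / √l := by
    intro m _
    set S := I.filter (fun n => ⌊g n⌋ = m) with hS
    have hSm : ∀ n ∈ S, A ≤ n ∧ n < B ∧ (m : ℝ) ≤ g n ∧ g n < m + 1 := by
      intro n hn
      rw [hS, Finset.mem_filter, hI, Finset.mem_Ico, Int.floor_eq_iff] at hn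
      exact ⟨hn.1.1, hn.1.2, hn.2.1, hn.2.2⟩
    have triv : ∀ s : Finset ℕ, s ⊆ I → ∀ α : ℝ, (∀ n ∈ s, α ≤ g n ∧ g n ≤ α + √l) →
        ‖∑ n ∈ s, e (f n)‖ ≤ 1 / √l + 1 := by
      intro s hs α hα
      have h1 := card_le_of_steps g hl hsl.le A B hg1 s hs hα
      have h2 : ‖∑ n ∈ s, e (f n)‖ ≤ s.card := by
        refine (norm_sum_le _ _).trans ?_
        simp [norm_e]
      have h3 : √l / l = 1 / √l := by
        rw [div_eq_div_iff hl.ne' hsl.ne']; linarith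
      linarith
    rw [← Finset.sum_filter_add_sum_filter_not S (fun n => g n < m + √l)]
    rw [← Finset.sum_filter_add_sum_filter_not (S.filter (fun n => ¬ g n < m + √l))
      (fun n => m + 1 - √l < g n)]
    have b1 : ‖∑ n ∈ S with g n < m + √l, e (f n)‖ ≤ 1 / √l + 1 := by
      refine triv _ (fun n hn => ?_) m (fun n hn => ?_)
      · exact (Finset.filter_subset _ _) ((Finset.filter_subset _ _) hn)
      · rw [Finset.mem_filter] at hn
        exact ⟨(hSm n hn.1).2.2.1, hn.2.le⟩
    have b2 : ‖∑ n ∈ S.filter (fun n => ¬ g n < m + √l) with m + 1 - √l < g n, e (f n)‖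
        ≤ 1 / √l + 1 := by
      refine triv _ (fun n hn => ?_) (m + 1 - √l) (fun n hn => ?_)
      · exact (Finset.filter_subset _ _) ((Finset.filter_subset _ _) ((Finset.filter_subset _ _) hn))
      · rw [Finset.mem_filter, Finset.mem_filter] at hn
        have := hSm n hn.1.1
        exact ⟨hn.2.le, by linarith [this.2.2.2]⟩
    have b3 : ‖∑ n ∈ S.filter (fun n => ¬ g n < m + √l) with ¬ m + 1 - √l < g n, e (f n)‖
        ≤ 1 / √l := by
      set W := (S.filter (fun n => ¬ g n < m + √l)).filter (fun n => ¬ m + 1 - √l < g n) with hW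
      have hWm : ∀ n, n ∈ W ↔ (A ≤ n ∧ n < B) ∧ m + √l ≤ g n ∧ g n ≤ m + 1 - √l := by
        intro n
        rw [hW, Finset.mem_filter, Finset.mem_filter, hS, Finset.mem_filter, hI, Finset.mem_Ico,
          Int.floor_eq_iff, not_lt, not_lt]
        constructor
        · rintro ⟨⟨⟨h1, _⟩, h2⟩, h3⟩
          exact ⟨h1, h2, h3⟩
        · rintro ⟨h1, h2, h3⟩
          exact ⟨⟨⟨h1, by linarith, by linarith⟩, h2⟩, h3⟩
      obtain ⟨a, b, hab⟩ := exists_eq_Ico_of_ordConnected W (by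
        intro x hx y hy z hxz hzy
        rw [hWm] at hx hy ⊢
        have h1 := hmono' x z hx.1.1 hxz (by omega)
        have h2 := hmono' z y (by omega) hzy hy.1.2
        exact ⟨⟨by omega, by omega⟩, by linarith, by linarith⟩)
      rw [hab]
      have hmem : ∀ n, a ≤ n → n < b → (A ≤ n ∧ n < B) ∧ m + √l ≤ g n ∧ g n ≤ m + 1 - √l := by
        intro n h1 h2
        rw [← hWm, hab, Finset.mem_Ico]; exact ⟨h1, h2⟩
      refine norm_sum_e_le_of_increments f hsl m a b (fun n h1 h2 => (hmem n h1 h2).2)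
        (fun n h1 h2 => ?_)
      have h3 := hmem n h1 (by omega)
      have h4 := hmem (n + 1) (by omega) h2
      exact hmono' n (n + 1) h3.1.1 (by omega) h4.1.2
    refine (norm_add_le _ _).trans ?_
    refine (add_le_add b1 ((norm_add_le _ _).trans (add_le_add b2 b3))).trans ?_
    have : √l ≤ 1 := Real.sqrt_le_one.2 hl1
    have h1 : 1 ≤ 1 / √l := by rw [le_div_iff₀ hsl]; linarith
    have h2 : 5 / √l = 5 * (1 / √l) := by ring
    linarith
  rw [← Finset.sum_fiberwise_of_maps_to hmaps]
  refine (norm_sum_le _ _).trans ((Finset.sum_le_sum hfib).trans ?_)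
  rw [Finset.sum_const, nsmul_eq_mul, hT, Int.card_Icc]
  have hcard : ((⌊g (B - 1)⌋ + 1 - ⌊g A⌋).toNat : ℝ) ≤ K * l * (B - A) + 2 := by
    have h1 : ⌊g A⌋ ≤ ⌊g (B - 1)⌋ :=
      Int.floor_mono (hmono' _ _ le_rfl (by omega) (by omega))
    have h2 : ((⌊g (B - 1)⌋ + 1 - ⌊g A⌋).toNat : ℝ) = ⌊g (B - 1)⌋ + 1 - ⌊g A⌋ := by
      have : (((⌊g (B - 1)⌋ + 1 - ⌊g A⌋).toNat : ℤ) : ℝ) = ((⌊g (B - 1)⌋ + 1 - ⌊g A⌋ : ℤ) : ℝ) := by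
        rw [Int.toNat_of_nonneg (by omega)]
      push_cast at this
      exact this
    rw [h2]
    have h3 := Int.floor_le (g (B - 1))
    have h4 := Int.lt_floor_add_one (g A)
    have h5 := hg2 (B - 1 - A) A le_rfl (by omega)
    rw [show A + (B - 1 - A) = B - 1 by omega] at h5
    have h6 : ((B - 1 - A : ℕ) : ℝ) ≤ B - A := by
      rw [← Nat.cast_sub hAB]; exact_mod_cast (by omega)
    have h7 : ((B - 1 - A : ℕ) : ℝ) * (K * l) ≤ (B - A) * (K * l) :=
      mul_le_mul_of_nonneg_right h6 (by positivity)
    linarith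
  calc ((⌊g (B - 1)⌋ + 1 - ⌊g A⌋).toNat : ℝ) * (5 / √l) ≤ (K * l * (B - A) + 2) * (5 / √l) :=
        mul_le_mul_of_nonneg_right hcard (by positivity)
    _ = _ := by
      have : l * (5 / √l) = 5 * √l := by field_simp; linarith
      linear_combination K * (B - A) * this

/-! ### The sawtooth and its exponential sums -/

/-- The sawtooth function `{y} - 1/2`. -/
noncomputable def sawtooth (y : ℝ) : ℝ := Int.fract y - 1 / 2

/-- The periodic Bernoulli function `B₂({y}) / 2`, an antiderivative of the sawtooth. -/
noncomputable def bern (y : ℝ) : ℝ := (Int.fract y ^ 2 - Int.fract y + 1 / 6) / 2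

lemma abs_sawtooth_le (y : ℝ) : |sawtooth y| ≤ 1 := by
  have h1 := Int.fract_nonneg y
  have h2 := Int.fract_lt_one y
  rw [sawtooth, abs_le]
  constructor <;> linarith

lemma cos_two_pi_mul_fract (k : ℕ) (y : ℝ) :
    Real.cos (2 * Real.pi * (k * Int.fract y)) = Real.cos (2 * Real.pi * (k * y)) := by
  have h : 2 * Real.pi * (k * y) =
      2 * Real.pi * (k * Int.fract y) + ((k * ⌊y⌋ : ℤ) : ℝ) * (2 * Real.pi) := by
    conv_lhs => rw [← Int.floor_add_fract y]
    push_cast; ring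
  rw [h, Real.cos_add_int_mul_two_pi]

lemma hasSum_bern (y : ℝ) :
    HasSum (fun k : ℕ => 1 / (2 * Real.pi ^ 2 * (k : ℝ) ^ 2) * Real.cos (2 * Real.pi * (k * y)))
      (bern y) := by
  have h := hasSum_one_div_nat_pow_mul_cos (k := 1) one_ne_zero
    (x := Int.fract y) ⟨Int.fract_nonneg y, (Int.fract_lt_one y).le⟩
  have h2 := h.mul_left (1 / (2 * Real.pi ^ 2))
  have h3 : (Polynomial.map (algebraMap ℚ ℝ) (Polynomial.bernoulli (2 * 1))).eval (Int.fract y) =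
      Int.fract y ^ 2 - Int.fract y + 1 / 6 := by
    rw [mul_one, Polynomial.bernoulli_def]
    simp [Finset.sum_range_succ, bernoulli_one, bernoulli_two]
    ring
  have h4 : bern y = 1 / (2 * Real.pi ^ 2) * ((-1) ^ (1 + 1) * (2 * Real.pi) ^ (2 * 1) / 2 /
      ((2 * 1).factorial : ℝ) * (Int.fract y ^ 2 - Int.fract y + 1 / 6)) := by
    have hp := Real.pi_ne_zero
    rw [bern]
    simp [Nat.factorial]
    field_simp
  rw [h3, ← h4] at h2
  have h5 : (fun k : ℕ => 1 / (2 * Real.pi ^ 2 * (k : ℝ) ^ 2) * Real.cos (2 * Real.pi * (k * y))) =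
      fun k : ℕ => 1 / (2 * Real.pi ^ 2) * (1 / (k : ℝ) ^ (2 * 1) *
        Real.cos (2 * Real.pi * k * Int.fract y)) := by
    ext k
    rw [← cos_two_pi_mul_fract k y, mul_one, mul_assoc (2 * Real.pi),
      ← mul_assoc (1 / (2 * Real.pi ^ 2)), one_div_mul_one_div]
  rw [h5]
  exact h2

lemma fract_add_eq (y t : ℝ) :
    Int.fract (y + t) = Int.fract (Int.fract y + t) := by
  rw [show y + t = Int.fract y + t + ⌊y⌋ by linarith [Int.floor_add_fract y], Int.fract_add_intCast]

/-- The sawtooth has slope `1` and jumps down only, so it is below its mean over `[y - δ, y]`, up to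
`δ`. -/
lemma sawtooth_le {y δ : ℝ} (h0 : 0 < δ) (h1 : δ < 1) :
    sawtooth y ≤ (bern y - bern (y + -δ)) / δ + δ := by
  have a1 := Int.fract_nonneg y
  have a2 := Int.fract_lt_one y
  rw [sawtooth, bern, bern, fract_add_eq]
  set u := Int.fract y
  have key : (u - 1 / 2 - δ) * δ ≤
      (u ^ 2 - u + 1 / 6) / 2 - (Int.fract (u + -δ) ^ 2 - Int.fract (u + -δ) + 1 / 6) / 2 := by
    rcases le_or_gt δ u with h | h
    · rw [Int.fract_eq_self.2 ⟨by linarith, by linarith⟩]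
      nlinarith
    · have : Int.fract (u + -δ) = u + -δ + 1 := by
        rw [← Int.fract_add_one, Int.fract_eq_self.2 ⟨by linarith, by linarith⟩]
      rw [this]
      nlinarith
  have := (le_div_iff₀ h0).2 key
  linarith

lemma le_sawtooth {y δ : ℝ} (h0 : 0 < δ) (h1 : δ < 1) :
    (bern (y + δ) - bern y) / δ - δ ≤ sawtooth y := by
  have a1 := Int.fract_nonneg y
  have a2 := Int.fract_lt_one y
  rw [sawtooth, bern, bern, fract_add_eq]
  set u := Int.fract y
  have key : (Int.fract (u + δ) ^ 2 - Int.fract (u + δ) + 1 / 6) / 2 - (u ^ 2 - u + 1 / 6) / 2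
      ≤ (u - 1 / 2 + δ) * δ := by
    rcases lt_or_ge (u + δ) 1 with h | h
    · rw [Int.fract_eq_self.2 ⟨by linarith, by linarith⟩]
      nlinarith
    · have : Int.fract (u + δ) = u + δ - 1 := by
        rw [← Int.fract_sub_one, Int.fract_eq_self.2 ⟨by linarith, by linarith⟩]
      rw [this]
      nlinarith
  have := (div_le_iff₀ h0).2 key
  linarith

/-- An interpolation between the bounds `2π|t|` and `2`. -/
lemma norm_e_sub_one_le {t θ : ℝ} (hθ0 : 0 ≤ θ) (hθ1 : θ ≤ 1) :
    ‖e t - 1‖ ≤ 2 * (Real.pi * |t|) ^ θ := by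
  have hx : 0 ≤ Real.pi * |t| := by positivity
  rcases le_total (Real.pi * |t|) 1 with h | h
  · have h1 : ‖e t - 1‖ ≤ 2 * (Real.pi * |t|) := by
      rw [e, mul_comm _ Complex.I]
      refine (Real.norm_exp_I_mul_ofReal_sub_one_le).trans (le_of_eq ?_)
      rw [Real.norm_eq_abs, abs_mul, abs_of_pos Real.two_pi_pos]; ring
    have h2 : Real.pi * |t| ≤ (Real.pi * |t|) ^ θ := Real.self_le_rpow_of_le_one hx h hθ1
    linarith
  · have h1 : ‖e t - 1‖ ≤ 2 := by
      refine (norm_sub_le _ _).trans ?_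
      rw [norm_e, norm_one]; norm_num
    have h2 := Real.one_le_rpow h hθ0
    linarith

lemma summable_natCast_rpow_sub {θ : ℝ} (hθ : θ < 1 / 2) :
    Summable (fun k : ℕ => (k : ℝ) ^ (θ - 3 / 2)) :=
  Real.summable_nat_rpow.2 (by linarith)

/-- Increments of the periodic Bernoulli function along a sequence, in terms of the exponential sums
of the sequence. -/
lemma abs_sum_bern_sub_le {θ : ℝ} (hθ0 : 0 ≤ θ) (hθ1 : θ < 1 / 2) (s : Finset ℕ) (z : ℕ → ℝ)
    {U : ℝ} (hU : 0 ≤ U)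
    (h : ∀ k : ℕ, 1 ≤ k → ‖∑ n ∈ s, e (k * z n)‖ ≤ U * √k) (τ : ℝ) :
    |∑ n ∈ s, (bern (z n + τ) - bern (z n))| ≤
      |τ| ^ θ * U * ∑' k : ℕ, (k : ℝ) ^ (θ - 3 / 2) := by
  have hs : HasSum (fun k : ℕ => ∑ n ∈ s,
      (1 / (2 * Real.pi ^ 2 * (k : ℝ) ^ 2) * Real.cos (2 * Real.pi * (k * (z n + τ))) -
       1 / (2 * Real.pi ^ 2 * (k : ℝ) ^ 2) * Real.cos (2 * Real.pi * (k * z n))))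
      (∑ n ∈ s, (bern (z n + τ) - bern (z n))) :=
    hasSum_sum fun n _ => (hasSum_bern (z n + τ)).sub (hasSum_bern (z n))
  have hterm : ∀ k : ℕ, ‖∑ n ∈ s,
      (1 / (2 * Real.pi ^ 2 * (k : ℝ) ^ 2) * Real.cos (2 * Real.pi * (k * (z n + τ))) -
       1 / (2 * Real.pi ^ 2 * (k : ℝ) ^ 2) * Real.cos (2 * Real.pi * (k * z n)))‖ ≤
      |τ| ^ θ * U * (k : ℝ) ^ (θ - 3 / 2) := by
    intro k
    rcases Nat.eq_zero_or_pos k with rfl | hk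
    · simp; positivity
    have hk0 : (0 : ℝ) < k := by exact_mod_cast hk
    have h1 : ∑ n ∈ s,
      (1 / (2 * Real.pi ^ 2 * (k : ℝ) ^ 2) * Real.cos (2 * Real.pi * (k * (z n + τ))) -
       1 / (2 * Real.pi ^ 2 * (k : ℝ) ^ 2) * Real.cos (2 * Real.pi * (k * z n))) =
       1 / (2 * Real.pi ^ 2 * (k : ℝ) ^ 2) * ((e (k * τ) - 1) * ∑ n ∈ s, e (k * z n)).re := by
      rw [Finset.mul_sum, Complex.re_sum, Finset.mul_sum]
      refine Finset.sum_congr rfl fun n _ => ?_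
      rw [sub_mul, ← e_add, one_mul, Complex.sub_re, e_re, e_re, ← mul_sub, ← mul_add, add_comm τ]
    rw [h1, norm_mul, Real.norm_eq_abs, Real.norm_eq_abs, abs_of_nonneg (by positivity)]
    have h2 : |((e (k * τ) - 1) * ∑ n ∈ s, e (k * z n)).re| ≤
        2 * (Real.pi * |k * τ|) ^ θ * (U * √k) := by
      refine (Complex.abs_re_le_norm _).trans ?_
      rw [norm_mul]
      exact mul_le_mul (norm_e_sub_one_le hθ0 (by linarith)) (h k hk) (norm_nonneg _)
        (by positivity)
    refine (mul_le_mul_of_nonneg_left h2 (by positivity)).trans ?_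
    have h3 : (Real.pi * |k * τ|) ^ θ = Real.pi ^ θ * (k : ℝ) ^ θ * |τ| ^ θ := by
      rw [abs_mul, abs_of_pos hk0, ← mul_assoc, Real.mul_rpow (by positivity) (by positivity),
        Real.mul_rpow (by positivity) (by positivity)]
    have h4 : (k : ℝ) ^ (θ - 3 / 2) * (k : ℝ) ^ 2 = (k : ℝ) ^ θ * √k := by
      rw [Real.sqrt_eq_rpow, ← Real.rpow_natCast, ← Real.rpow_add hk0, ← Real.rpow_add hk0]
      congr 1; push_cast; ring
    have h5 : Real.pi ^ θ ≤ Real.pi ^ 2 := by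
      rw [← Real.rpow_natCast]
      exact Real.rpow_le_rpow_of_exponent_le (by linarith [Real.pi_gt_three])
        (by push_cast; linarith)
    rw [h3]
    have hp := Real.pi_pos
    calc 1 / (2 * Real.pi ^ 2 * (k : ℝ) ^ 2) * (2 * (Real.pi ^ θ * k ^ θ * |τ| ^ θ) * (U * √k))
        = Real.pi ^ θ / (Real.pi ^ 2) * (|τ| ^ θ * U * (((k : ℝ) ^ θ * √k) / (k : ℝ) ^ 2)) := by
          field_simp
      _ ≤ 1 * (|τ| ^ θ * U * (((k : ℝ) ^ θ * √k) / (k : ℝ) ^ 2)) := by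
          refine mul_le_mul_of_nonneg_right ?_ (by positivity)
          rw [div_le_one (by positivity)]; exact h5
      _ = _ := by
          rw [← h4]; field_simp
  have := ((summable_natCast_rpow_sub hθ1).hasSum.mul_left (|τ| ^ θ * U))
  exact HasSum.norm_le_of_bounded hs this hterm

/-- A sum of sawtooth values is small when the corresponding exponential sums are. -/
theorem abs_sum_sawtooth_le {θ : ℝ} (hθ0 : 0 ≤ θ) (hθ1 : θ < 1 / 2) (s : Finset ℕ) (z : ℕ → ℝ)
    {U : ℝ} (hU : 0 ≤ U)
    (h : ∀ k : ℕ, 1 ≤ k → ‖∑ n ∈ s, e (k * z n)‖ ≤ U * √k) {δ : ℝ} (h0 : 0 < δ) (h1 : δ < 1) :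
    |∑ n ∈ s, sawtooth (z n)| ≤
      δ * s.card + δ ^ (θ - 1) * U * ∑' k : ℕ, (k : ℝ) ^ (θ - 3 / 2) := by
  have b1 := abs_sum_bern_sub_le hθ0 hθ1 s z hU h δ
  have b2 := abs_sum_bern_sub_le hθ0 hθ1 s z hU h (-δ)
  rw [abs_neg] at b2
  rw [abs_of_pos h0] at b1 b2
  set C := ∑' k : ℕ, (k : ℝ) ^ (θ - 3 / 2)
  have e1 : δ ^ (θ - 1) * U * C = (δ ^ θ * U * C) / δ := by
    rw [Real.rpow_sub_one h0.ne']; ring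
  have u1 : ∑ n ∈ s, sawtooth (z n) ≤
      ∑ n ∈ s, (-(bern (z n + -δ) - bern (z n)) / δ + δ) :=
    Finset.sum_le_sum fun n _ => by
      have := sawtooth_le (y := z n) h0 h1
      rwa [neg_sub]
  have u2 : ∑ n ∈ s, ((bern (z n + δ) - bern (z n)) / δ - δ) ≤ ∑ n ∈ s, sawtooth (z n) :=
    Finset.sum_le_sum fun n _ => le_sawtooth h0 h1
  rw [Finset.sum_add_distrib, ← Finset.sum_div, Finset.sum_neg_distrib, Finset.sum_const,
    nsmul_eq_mul] at u1
  rw [Finset.sum_sub_distrib, ← Finset.sum_div, Finset.sum_const, nsmul_eq_mul] at u2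
  have v1 := div_le_div_of_nonneg_right (neg_le_of_abs_le b2) h0.le
  have v2 := div_le_div_of_nonneg_right (neg_le_of_abs_le b1) h0.le
  rw [e1, abs_le]
  rw [neg_div] at u1 v1 v2
  constructor <;> linarith

/-! ### Sawtooth sums along `y / n` -/

/-- The exponential sums `∑ e(ky/n)` over a dyadic block. -/
lemma norm_sum_e_div_le {y : ℝ} {D : ℕ} (hD : 1 ≤ D) (hDy : (D : ℝ) ^ 2 ≤ 2 * y) {k : ℕ}
    (hk : 1 ≤ k) :
    ‖∑ n ∈ Finset.Ico (D / 2 + 1) (D + 1), e (k * (y / n))‖ ≤ 100 * √(y / D) * √k := by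
  have hD0 : (1 : ℝ) ≤ D := by exact_mod_cast hD
  have hk0 : (1 : ℝ) ≤ k := by exact_mod_cast hk
  have hy : 0 < y := by nlinarith
  set l : ℝ := 2 * k * y / (D : ℝ) ^ 3 with hl
  have hl0 : 0 < l := by positivity
  have h := norm_sum_e_le_of_second_differences (fun n : ℕ => k * (y / n)) (K := 8) hl0
    (D / 2 + 1) (D + 1) ?_ (by norm_num) (by omega)
  · refine h.trans ?_
    have hs : √l * √l = l := Real.mul_self_sqrt hl0.le
    have hs0 : 0 < √l := Real.sqrt_pos.2 hl0
    have h1 : D * √l = √2 * √(y / D) * √k := by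
      rw [← Real.sqrt_mul (by norm_num), ← Real.sqrt_mul (by positivity), hl]
      nth_rewrite 1 [← Real.sqrt_sq (by positivity : (0 : ℝ) ≤ D)]
      rw [← Real.sqrt_mul (by positivity)]
      congr 1
      field_simp
    have h2 : 1 / √l ≤ D * √l := by
      rw [div_le_iff₀ hs0, mul_assoc, hs, hl]
      rw [show (D : ℝ) * (2 * k * y / (D : ℝ) ^ 3) = (2 * y) * k / (D : ℝ) ^ 2 by field_simp,
        le_div_iff₀ (by positivity)]
      nlinarith
    have h3 : (((D + 1 : ℕ) : ℝ) - ((D / 2 + 1 : ℕ) : ℝ)) ≤ D := by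
      have : (0 : ℝ) ≤ ((D / 2 : ℕ) : ℝ) := by positivity
      push_cast at this ⊢
      linarith
    have h4 : √2 ≤ 2 := by
      rw [Real.sqrt_le_left (by norm_num)]; norm_num
    have h5 : 0 ≤ √(y / D) * √k := by positivity
    have h6 : √2 * √(y / D) * √k ≤ 2 * (√(y / D) * √k) := by
      rw [mul_assoc]; exact mul_le_mul_of_nonneg_right h4 h5
    have h7 : 8 * (((D + 1 : ℕ) : ℝ) - ((D / 2 + 1 : ℕ) : ℝ)) * √l ≤ 8 * D * √l := by
      apply mul_le_mul_of_nonneg_right _ hs0.le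
      linarith
    have h8 : 2 / √l = 2 * (1 / √l) := by ring
    nlinarith
  · intro n h1 h2
    have hn : (D : ℝ) ≤ 2 * n := by exact_mod_cast (by omega : D ≤ 2 * n)
    have hn2 : (n : ℝ) + 1 ≤ D := by exact_mod_cast (by omega : n + 1 ≤ D)
    have hn0 : (0 : ℝ) < n := by linarith
    have e1 : (k : ℝ) * (y / (n + 2 : ℕ)) - 2 * (k * (y / (n + 1 : ℕ))) + k * (y / n) =
        2 * k * y / (n * (n + 1) * (n + 2)) := by
      push_cast; field_simp; ring
    rw [e1]
    have l1 : (n : ℝ) * (n + 1) * (n + 2) ≤ (D : ℝ) ^ 3 := by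
      have : (n : ℝ) * (n + 2) ≤ (n + 1) ^ 2 := by nlinarith
      calc (n : ℝ) * (n + 1) * (n + 2) = (n * (n + 2)) * (n + 1) := by ring
        _ ≤ (n + 1) ^ 2 * (n + 1) := by gcongr
        _ = (n + 1 : ℝ) ^ 3 := by ring
        _ ≤ (D : ℝ) ^ 3 := by gcongr
    have l2 : (D : ℝ) ^ 3 ≤ 8 * ((n : ℝ) * (n + 1) * (n + 2)) := by
      calc (D : ℝ) ^ 3 ≤ (2 * n : ℝ) ^ 3 := by gcongr
        _ = 8 * (n * n * n : ℝ) := by ring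
        _ ≤ 8 * ((n : ℝ) * (n + 1) * (n + 2)) := by gcongr <;> linarith
    constructor
    · rw [hl]; gcongr
    · rw [hl, ← mul_div_assoc, div_le_div_iff₀ (by positivity) (by positivity)]
      calc 2 * (k : ℝ) * y * (D : ℝ) ^ 3 ≤ 2 * (k : ℝ) * y * (8 * ((n : ℝ) * (n + 1) * (n + 2))) := by
            gcongr
        _ = _ := by ring

/-- The sawtooth sum over a dyadic block; the width of the smoothing is `y^{1/3} / D`. -/
lemma exists_abs_sum_sawtooth_block_le {ε : ℝ} (h0 : 0 < ε) (h1 : ε ≤ 1 / 2) :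
    ∃ K : ℝ, 0 ≤ K ∧ ∀ y : ℝ, 1 ≤ y → ∀ D : ℕ, (D : ℝ) ^ 2 ≤ 2 * y →
      |∑ n ∈ Finset.Ico (D / 2 + 1) (D + 1), sawtooth (y / n)| ≤ K * y ^ (1 / 3 + ε) := by
  set C := ∑' k : ℕ, (k : ℝ) ^ ((1 / 2 - ε) - 3 / 2) with hC
  have hC0 : 0 ≤ C := tsum_nonneg fun k => by positivity
  -- The sum over frequencies converges for every exponent `θ < 1/2`; taking `θ = 1/2 - ε` costs
  -- a factor `y^ε`.
  refine ⟨1 + 200 * C, by positivity, fun y hy D hD => ?_⟩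
  have hy0 : 0 < y := by linarith
  have hcard : ((Finset.Ico (D / 2 + 1) (D + 1)).card : ℝ) ≤ D := by
    rw [Nat.card_Ico]; exact_mod_cast (by omega)
  have hmono : y ^ (1 / 3 : ℝ) ≤ y ^ (1 / 3 + ε) :=
    Real.rpow_le_rpow_of_exponent_le hy (by linarith)
  have hpos : 0 < y ^ (1 / 3 : ℝ) := by positivity
  rcases le_or_gt (D : ℝ) (y ^ (1 / 3 : ℝ)) with hsm | hbig
  · have : |∑ n ∈ Finset.Ico (D / 2 + 1) (D + 1), sawtooth (y / n)| ≤ D := by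
      refine (Finset.abs_sum_le_sum_abs _ _).trans
        ((Finset.sum_le_sum fun n _ => abs_sawtooth_le _).trans ?_)
      simp
    have h3 : 0 ≤ 200 * C * y ^ (1 / 3 + ε) := by positivity
    linarith
  have hD1 : 1 ≤ D := by
    have : (0 : ℝ) < D := by linarith
    exact_mod_cast this
  have hD0 : (1 : ℝ) ≤ D := by exact_mod_cast hD1
  set δ := y ^ (1 / 3 : ℝ) / D with hδ
  have hδ0 : 0 < δ := by positivity
  have hδ1 : δ < 1 := by rw [hδ, div_lt_one (by linarith)]; exact hbig
  have h := abs_sum_sawtooth_le (θ := 1 / 2 - ε) (by linarith) (by linarith)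
    (Finset.Ico (D / 2 + 1) (D + 1)) (fun n => y / n) (U := 100 * √(y / D)) (by positivity)
    (fun k hk => norm_sum_e_div_le hD1 hD hk) hδ0 hδ1
  refine h.trans ?_
  have a1 : δ * ((Finset.Ico (D / 2 + 1) (D + 1)).card : ℝ) ≤ y ^ (1 / 3 + ε) := by
    refine (mul_le_mul_of_nonneg_left hcard hδ0.le).trans ?_
    rw [hδ, div_mul_cancel₀ _ (by positivity)]
    exact hmono
  have a2 : δ ^ ((1 / 2 - ε) - 1) * √(y / D) = y ^ (1 / 3 - ε / 3) * (D : ℝ) ^ ε := by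
    rw [hδ, Real.sqrt_eq_rpow, Real.div_rpow (by positivity) (by positivity),
      Real.div_rpow (by positivity) (by positivity), ← Real.rpow_mul hy0.le, div_mul_div_comm,
      ← Real.rpow_add hy0, ← Real.rpow_add (by linarith), div_eq_mul_inv,
      ← Real.rpow_neg (by positivity)]
    congr 2 <;> ring
  have a3 : (D : ℝ) ^ ε ≤ 2 * y ^ ε := by
    have : (D : ℝ) ≤ 2 * y := by nlinarith
    calc (D : ℝ) ^ ε ≤ (2 * y) ^ ε := by gcongr
      _ = 2 ^ ε * y ^ ε := Real.mul_rpow (by norm_num) hy0.le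
      _ ≤ 2 ^ (1 : ℝ) * y ^ ε := by gcongr <;> linarith
      _ = _ := by rw [Real.rpow_one]
  have a4 : y ^ (1 / 3 - ε / 3) * (D : ℝ) ^ ε ≤ 2 * y ^ (1 / 3 + ε) := by
    calc y ^ (1 / 3 - ε / 3) * (D : ℝ) ^ ε ≤ y ^ (1 / 3 : ℝ) * (2 * y ^ ε) := by
          gcongr
          linarith
      _ = _ := by rw [Real.rpow_add hy0]; ring
  have a5 : δ ^ ((1 / 2 - ε) - 1) * (100 * √(y / D)) * C = 100 * C *
      (δ ^ ((1 / 2 - ε) - 1) * √(y / D)) := by ring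
  rw [a5, a2]
  have := mul_le_mul_of_nonneg_left a4 (by positivity : 0 ≤ 100 * C)
  linarith

lemma exists_abs_sum_sawtooth_le_aux {ε : ℝ} (h0 : 0 < ε) (h1 : ε ≤ 1 / 2) :
    ∃ K : ℝ, 0 ≤ K ∧ ∀ y : ℝ, 1 ≤ y → ∀ D : ℕ, (D : ℝ) ^ 2 ≤ 2 * y →
      |∑ n ∈ Finset.Ico 1 (D + 1), sawtooth (y / n)| ≤ K * y ^ (1 / 3 + ε) * (D : ℝ) ^ ε := by
  obtain ⟨K, hK0, hK⟩ := exists_abs_sum_sawtooth_block_le h0 h1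
  have hr1 : (1 / 2 : ℝ) ^ ε < 1 := Real.rpow_lt_one (by norm_num) (by norm_num) h0
  have hr0 : (0 : ℝ) < (1 / 2 : ℝ) ^ ε := by positivity
  set r := (1 / 2 : ℝ) ^ ε
  -- The blocks add up to a geometric series of ratio `r`.
  refine ⟨K / (1 - r), div_nonneg hK0 (by linarith), fun y hy D => ?_⟩
  induction D using Nat.strong_induction_on with
  | _ D ih =>
    intro hD
    rcases Nat.eq_zero_or_pos D with rfl | hpos
    · simp; positivity
    have hhalf : ((D / 2 : ℕ) : ℝ) ≤ D / 2 := Nat.cast_div_le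
    have hh0 : (0 : ℝ) ≤ ((D / 2 : ℕ) : ℝ) := by positivity
    have hD1 : (1 : ℝ) ≤ D := by exact_mod_cast hpos
    have i1 := ih (D / 2) (by omega) (by nlinarith)
    have i2 := hK y hy D hD
    have hyp : 0 ≤ y ^ (1 / 3 + ε) := by positivity
    rw [← Finset.sum_Ico_consecutive _ (by omega : 1 ≤ D / 2 + 1) (by omega : D / 2 + 1 ≤ D + 1)]
    refine (abs_add_le _ _).trans ((add_le_add i1 i2).trans ?_)
    have i3 : ((D / 2 : ℕ) : ℝ) ^ ε ≤ r * (D : ℝ) ^ ε := by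
      rw [← Real.mul_rpow (by norm_num) (by positivity)]
      refine Real.rpow_le_rpow hh0 (by linarith) h0.le
    have i4 : 1 ≤ (D : ℝ) ^ ε := Real.one_le_rpow hD1 h0.le
    have hKr : K / (1 - r) * r + K = K / (1 - r) := by
      have : 1 - r ≠ 0 := by linarith
      field_simp; ring
    calc K / (1 - r) * y ^ (1 / 3 + ε) * ((D / 2 : ℕ) : ℝ) ^ ε + K * y ^ (1 / 3 + ε)
        ≤ K / (1 - r) * y ^ (1 / 3 + ε) * (r * (D : ℝ) ^ ε) +
          K * y ^ (1 / 3 + ε) * (D : ℝ) ^ ε := by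
          have : 0 ≤ K / (1 - r) := div_nonneg hK0 (by linarith)
          refine add_le_add (mul_le_mul_of_nonneg_left i3 (by positivity)) ?_
          exact le_mul_of_one_le_right (by positivity) i4
      _ = (K / (1 - r) * r + K) * y ^ (1 / 3 + ε) * (D : ℝ) ^ ε := by ring
      _ = _ := by rw [hKr]

/-- Voronoi's estimate `∑_{n ≤ D} ψ(y/n) ≪ y^{1/3+ε}` for the sawtooth `ψ` and `D² ≤ 2y`. The bound
is in terms of any `N ≥ max(1, y)`, so that `y < 1` is allowed. -/
theorem exists_abs_sum_sawtooth_le {ε : ℝ} (h0 : 0 < ε) :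
    ∃ K : ℝ, 0 ≤ K ∧ ∀ N : ℝ, 1 ≤ N → ∀ y : ℝ, y ≤ N → ∀ D : ℕ, (D : ℝ) ^ 2 ≤ 2 * y →
      |∑ n ∈ Finset.Ico 1 (D + 1), sawtooth (y / n)| ≤ K * N ^ (1 / 3 + ε) := by
  set ε' := min (ε / 2) (1 / 2) with hε'
  have e0 : 0 < ε' := by rw [hε']; positivity
  have e1 : ε' ≤ 1 / 2 := min_le_right _ _
  have e2 : ε' ≤ ε / 2 := min_le_left _ _
  obtain ⟨K, hK0, hK⟩ := exists_abs_sum_sawtooth_le_aux e0 e1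
  refine ⟨2 * K + 1, by positivity, fun N hN y hyN D hD => ?_⟩
  have hN1 : 1 ≤ N ^ (1 / 3 + ε) := Real.one_le_rpow hN (by positivity)
  rcases lt_or_ge y 1 with hy | hy
  · have hD1 : D < 2 := by
      have : (D : ℝ) < 2 := by nlinarith
      exact_mod_cast this
    have : |∑ n ∈ Finset.Ico 1 (D + 1), sawtooth (y / n)| ≤ 1 := by
      refine (Finset.abs_sum_le_sum_abs _ _).trans
        ((Finset.sum_le_sum fun n _ => abs_sawtooth_le _).trans ?_)
      simp
      exact_mod_cast (by omega : D ≤ 1)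
    nlinarith
  · refine (hK y hy D hD).trans ?_
    have hy0 : 0 < y := by linarith
    have hDle : (D : ℝ) ≤ 2 * y := by nlinarith [(by positivity : (0 : ℝ) ≤ D)]
    have a3 : (D : ℝ) ^ ε' ≤ 2 * y ^ ε' := by
      calc (D : ℝ) ^ ε' ≤ (2 * y) ^ ε' := by gcongr
        _ = 2 ^ ε' * y ^ ε' := Real.mul_rpow (by norm_num) hy0.le
        _ ≤ 2 ^ (1 : ℝ) * y ^ ε' := by gcongr <;> linarith
        _ = _ := by rw [Real.rpow_one]
    calc K * y ^ (1 / 3 + ε') * (D : ℝ) ^ ε' ≤ K * y ^ (1 / 3 + ε') * (2 * y ^ ε') := by gcongr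
      _ = 2 * K * y ^ (1 / 3 + (ε' + ε')) := by
          rw [← add_assoc, Real.rpow_add hy0 (1 / 3 + ε') ε']; ring
      _ ≤ 2 * K * N ^ (1 / 3 + ε) := by
          have : y ^ (1 / 3 + (ε' + ε')) ≤ N ^ (1 / 3 + ε) :=
            (Real.rpow_le_rpow_of_exponent_le hy (by linarith)).trans
              (Real.rpow_le_rpow hy0.le hyN (by linarith))
          gcongr
      _ ≤ (2 * K + 1) * N ^ (1 / 3 + ε) := by nlinarith

/-! ### Parity of `N / d` -/

/-- The sign `(-1)^(n+1)`, the coefficient of the alternating zeta function for `n ≥ 1`. -/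
noncomputable def chi (n : ℕ) : ℝ := (-1) ^ (n + 1)

lemma chi_succ (n : ℕ) : chi (n + 1) = -chi n := by rw [chi, chi, pow_succ]; ring

lemma chi_two_mul (n : ℕ) : chi (2 * n) = -1 := by
  rw [chi]; exact Odd.neg_one_pow ⟨n, rfl⟩

lemma abs_chi (n : ℕ) : |chi n| = 1 := by rw [chi, abs_pow, abs_neg, abs_one, one_pow]

/-- The parity of the integer part in terms of the sawtooth. -/
lemma chi_floor (x : ℝ) (hx : 0 ≤ x) :
    chi ⌊x⌋₊ = -2 * sawtooth x + 4 * sawtooth (x / 2) := by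
  have h1 : Int.fract x = x - ⌊x⌋₊ := by
    rw [Int.fract, natCast_floor_eq_intCast_floor hx]
  have h2 : Int.fract (x / 2) = x / 2 - ((⌊x⌋₊ / 2 : ℕ) : ℝ) := by
    rw [Int.fract, ← natCast_floor_eq_intCast_floor (by positivity)]
    rw [show x / 2 = x / (2 : ℕ) by norm_num, Nat.floor_div_natCast]
  rw [sawtooth, sawtooth, h1, h2]
  obtain ⟨q, hq | hq⟩ := Nat.even_or_odd' ⌊x⌋₊
  · rw [hq, chi_two_mul, Nat.mul_div_cancel_left _ (by norm_num)]; push_cast; ring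
  · rw [hq, chi_succ, chi_two_mul, show (2 * q + 1) / 2 = q by omega]; push_cast; ring

/-- Splitting off the even terms, since `χ = 1 - 2 · 1_{2 ∣ n}`. -/
lemma sum_chi_mul (G : ℕ → ℝ) (D : ℕ) :
    ∑ d ∈ Finset.Ico 1 (D + 1), chi d * G d =
      ∑ d ∈ Finset.Ico 1 (D + 1), G d - 2 * ∑ d ∈ Finset.Ico 1 (D / 2 + 1), G (2 * d) := by
  induction D with
  | zero => simp
  | succ D ih =>
    rw [Finset.sum_Ico_succ_top (by omega), Finset.sum_Ico_succ_top (by omega : 1 ≤ D + 1) G, ih]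
    obtain ⟨q, hq | hq⟩ := Nat.even_or_odd' (D + 1)
    · have h1 : D / 2 + 1 = q := by omega
      rw [hq, Nat.mul_div_cancel_left _ (by norm_num), chi_two_mul, h1,
        Finset.sum_Ico_succ_top (by omega)]
      ring
    · have h1 : (D + 1) / 2 = D / 2 := by omega
      rw [h1, hq, chi_succ, chi_two_mul]
      ring

/-- The sum `∑_{d ≤ D} χ(d) χ(⌊N/d⌋)` for `D² ≤ N`. -/
theorem exists_abs_sum_chi_mul_chi_div_le {ε : ℝ} (h0 : 0 < ε) :
    ∃ K : ℝ, 0 ≤ K ∧ ∀ N : ℕ, 1 ≤ N → ∀ D : ℕ, D ^ 2 ≤ N →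
      |∑ d ∈ Finset.Ico 1 (D + 1), chi d * chi (N / d)| ≤ K * (N : ℝ) ^ (1 / 3 + ε) := by
  obtain ⟨K, hK0, hK⟩ := exists_abs_sum_sawtooth_le h0
  refine ⟨22 * K, by positivity, fun N hN D hD => ?_⟩
  have hN1 : (1 : ℝ) ≤ N := by exact_mod_cast hN
  have hD' : (D : ℝ) ^ 2 ≤ N := by exact_mod_cast hD
  have hhalf : ((D / 2 : ℕ) : ℝ) ≤ D / 2 := Nat.cast_div_le
  have hh0 : (0 : ℝ) ≤ ((D / 2 : ℕ) : ℝ) := by positivity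
  have hG : ∀ d : ℕ, chi (N / d) = -2 * sawtooth ((N : ℝ) / d) + 4 * sawtooth ((N : ℝ) / 2 / d) := by
    intro d
    have := chi_floor ((N : ℝ) / d) (by positivity)
    rw [Nat.floor_div_natCast, Nat.floor_natCast] at this
    rw [this, div_right_comm]
  rw [sum_chi_mul (fun d => chi (N / d)) D]
  have e1 : ∑ d ∈ Finset.Ico 1 (D + 1), chi (N / d) =
      -2 * ∑ d ∈ Finset.Ico 1 (D + 1), sawtooth ((N : ℝ) / d) +
      4 * ∑ d ∈ Finset.Ico 1 (D + 1), sawtooth ((N : ℝ) / 2 / d) := by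
    simp only [hG, Finset.sum_add_distrib, Finset.mul_sum]
  have e2 : ∑ d ∈ Finset.Ico 1 (D / 2 + 1), chi (N / (2 * d)) =
      -2 * ∑ d ∈ Finset.Ico 1 (D / 2 + 1), sawtooth ((N : ℝ) / 2 / d) +
      4 * ∑ d ∈ Finset.Ico 1 (D / 2 + 1), sawtooth ((N : ℝ) / 4 / d) := by
    rw [Finset.mul_sum, Finset.mul_sum, ← Finset.sum_add_distrib]
    refine Finset.sum_congr rfl fun d _ => ?_
    rw [hG]
    push_cast
    rw [← div_div, ← div_div, div_div (N : ℝ) 2 2]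
    norm_num
  rw [e1, e2]
  have b1 := abs_le.1 (hK N hN1 N le_rfl D (by linarith))
  have b2 := abs_le.1 (hK N hN1 (N / 2) (by linarith) D (by linarith))
  have b3 := abs_le.1 (hK N hN1 (N / 2) (by linarith) (D / 2) (by nlinarith))
  have b4 := abs_le.1 (hK N hN1 (N / 4) (by linarith) (D / 2) (by nlinarith))
  rw [abs_le]
  constructor <;> linarith [b1.1, b1.2, b2.1, b2.2, b3.1, b3.2, b4.1, b4.2]

/-! ### Summation by parts -/

/-- Summation by parts with monotone weights. -/
lemma abs_sum_mul_le_of_antitone (x w : ℕ → ℝ) {M : ℝ} (r : ℕ)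
    (hM : ∀ D ≤ r, |∑ d ∈ Finset.Ico 1 (D + 1), x d| ≤ M)
    (hw : ∀ d, 1 ≤ d → d + 1 ≤ r → w (d + 1) ≤ w d) (hw0 : ∀ d, 1 ≤ d → d ≤ r → 0 ≤ w d)
    (hr : 1 ≤ r) :
    |∑ d ∈ Finset.Ico 1 (r + 1), x d * w d| ≤ M * w 1 := by
  have key : ∀ k, 1 ≤ k → k ≤ r → |∑ d ∈ Finset.Ico 1 (k + 1), x d * w d -
      (∑ d ∈ Finset.Ico 1 (k + 1), x d) * w k| ≤ M * (w 1 - w k) := by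
    intro k hk
    induction k, hk using Nat.le_induction with
    | base => intro _; simp
    | succ k hk ih =>
      intro hkr
      have h1 := ih (by omega)
      have h2 := hM k (by omega)
      have h3 := hw k hk hkr
      rw [Finset.sum_Ico_succ_top (by omega : 1 ≤ k + 1),
        Finset.sum_Ico_succ_top (by omega : 1 ≤ k + 1) x]
      set X := ∑ d ∈ Finset.Ico 1 (k + 1), x d
      set Z := ∑ d ∈ Finset.Ico 1 (k + 1), x d * w d
      have e1 : Z + x (k + 1) * w (k + 1) - (X + x (k + 1)) * w (k + 1) =
          (Z - X * w k) + X * (w k - w (k + 1)) := by ring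
      rw [e1]
      refine (abs_add_le _ _).trans ?_
      rw [abs_mul, abs_of_nonneg (by linarith : 0 ≤ w k - w (k + 1))]
      have := mul_le_mul_of_nonneg_right h2 (by linarith : 0 ≤ w k - w (k + 1))
      linarith
  have h1 := key r hr le_rfl
  have h2 := mul_le_mul_of_nonneg_right (hM r le_rfl) (hw0 r hr le_rfl)
  rw [← abs_of_nonneg (hw0 r hr le_rfl), ← abs_mul, abs_of_nonneg (hw0 r hr le_rfl)] at h2
  have h3 := abs_add_le (∑ d ∈ Finset.Ico 1 (r + 1), x d * w d -
      (∑ d ∈ Finset.Ico 1 (r + 1), x d) * w r) ((∑ d ∈ Finset.Ico 1 (r + 1), x d) * w r)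
  rw [sub_add_cancel] at h3
  linarith

/-- Summation by parts against the alternating sign `χ`, using `χ(n+1) = -χ(n)`. -/
lemma two_mul_sum_chi_mul (v : ℕ → ℝ) {a b : ℕ} (hab : a ≤ b) :
    2 * ∑ n ∈ Finset.Ico a b, chi n * v n = chi a * v a - chi b * v b +
      ∑ n ∈ Finset.Ico a b, chi n * (v n - v (n + 1)) := by
  induction b, hab using Nat.le_induction with
  | base => simp
  | succ b hb ih =>
    rw [Finset.sum_Ico_succ_top hb, Finset.sum_Ico_succ_top hb, mul_add, ih, chi_succ]
    ring

lemma abs_sum_chi_mul_le (v : ℕ → ℝ) {a b : ℕ} (hab : a ≤ b) :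
    2 * |∑ n ∈ Finset.Ico a b, chi n * v n| ≤ |v a| + |v b| +
      ∑ n ∈ Finset.Ico a b, |v n - v (n + 1)| := by
  have h : 2 * |∑ n ∈ Finset.Ico a b, chi n * v n| = |2 * ∑ n ∈ Finset.Ico a b, chi n * v n| := by
    rw [abs_mul, abs_two]
  rw [h, two_mul_sum_chi_mul v hab]
  refine (abs_add_le _ _).trans (add_le_add ((abs_sub _ _).trans ?_)
    ((Finset.abs_sum_le_sum_abs _ _).trans ?_))
  · rw [abs_mul, abs_mul, abs_chi, abs_chi, one_mul, one_mul]
  · refine Finset.sum_le_sum fun n _ => ?_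
    rw [abs_mul, abs_chi, one_mul]

lemma sum_one_div_sq_le {d Y : ℕ} (hd : 1 ≤ d) (hdY : d ≤ Y) :
    ∑ n ∈ Finset.Ico d Y, 1 / (n : ℝ) ^ 2 ≤ 2 / (d : ℝ) - 2 / (Y : ℝ) := by
  induction Y, hdY using Nat.le_induction with
  | base => simp
  | succ Y hY ih =>
    rw [Finset.sum_Ico_succ_top hY]
    have hY0 : (1 : ℝ) ≤ Y := by exact_mod_cast hd.trans hY
    have : 1 / (Y : ℝ) ^ 2 ≤ 2 / Y - 2 / ((Y + 1 : ℕ) : ℝ) := by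
      push_cast
      rw [div_sub_div _ _ (by positivity) (by positivity),
        div_le_div_iff₀ (by positivity) (by positivity)]
      nlinarith [mul_nonneg (by linarith : (0:ℝ) ≤ Y) (by linarith : (0:ℝ) ≤ Y - 1)]
    linarith

lemma log_succ_sub_log_le {n : ℝ} (hn : 0 < n) : Real.log (n + 1) - Real.log n ≤ 1 / n := by
  rw [← Real.log_div (by positivity) hn.ne']
  refine (Real.log_le_sub_one_of_pos (by positivity)).trans (le_of_eq ?_)
  field_simp; ring

/-- The inner sum of the hyperbola method. The weight `log²(e/d)` vanishes at `e = d`, so that two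
summations by parts leave only the boundary term at `Y`. -/
lemma abs_sum_chi_mul_log_sq_sub_le {d Y N : ℕ} (hd : 1 ≤ d) (hdY : d ≤ Y) (hYN : Y ≤ N) :
    |∑ n ∈ Finset.Ico (d + 1) (Y + 1), chi n * (Real.log n - Real.log d) ^ 2 -
      1 / 2 * chi Y * (Real.log Y - Real.log d) ^ 2| ≤ (2 * Real.log (N + 2) + 1) / d := by
  set L := Real.log (N + 2) with hL
  have hd0 : (1 : ℝ) ≤ d := by exact_mod_cast hd
  set w : ℕ → ℝ := fun n => (Real.log n - Real.log d) ^ 2 with hw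
  set u : ℕ → ℝ := fun n => w n - w (n + 1) with hu
  have hL0 : 0 ≤ L := Real.log_nonneg (by have : (0 : ℝ) ≤ N := by positivity
                                          linarith)
  have hwd : w d = 0 := by simp [hw]
  have e1 : ∑ n ∈ Finset.Ico (d + 1) (Y + 1), chi n * w n =
      ∑ n ∈ Finset.Ico d Y, chi n * w n + chi Y * w Y := by
    rw [← Finset.sum_Ico_succ_top hdY, Finset.sum_eq_sum_Ico_succ_bot (by omega : d < Y + 1), hwd]
    ring
  have e2 := two_mul_sum_chi_mul w hdY
  have e3 : ∑ n ∈ Finset.Ico (d + 1) (Y + 1), chi n * w n - 1 / 2 * chi Y * w Y =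
      1 / 2 * ∑ n ∈ Finset.Ico d Y, chi n * u n := by
    rw [e1]; rw [hwd] at e2; linarith
  have hfac : ∀ n : ℕ, u n = -((Real.log (n + 1) - Real.log n) *
      ((Real.log (n + 1) - Real.log d) + (Real.log n - Real.log d))) := by
    intro n
    simp only [hu, hw]; push_cast; ring
  have hlog : ∀ n : ℕ, d ≤ n → n ≤ Y + 2 → 0 ≤ Real.log n - Real.log d ∧
      Real.log n - Real.log d ≤ L := by
    intro n h1 h2
    have h3 : (d : ℝ) ≤ n := by exact_mod_cast h1
    have h4 : (n : ℝ) ≤ N + 2 := by exact_mod_cast (by omega : n ≤ N + 2)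
    have h5 := Real.log_le_log (by linarith) h3
    have h6 := Real.log_le_log (by linarith) h4
    have h7 := Real.log_nonneg hd0
    constructor <;> linarith
  have hα : ∀ n : ℕ, d ≤ n → 0 ≤ Real.log (n + 1) - Real.log n ∧
      Real.log (n + 1) - Real.log n ≤ 1 / n := by
    intro n h1
    have h3 : (d : ℝ) ≤ n := by exact_mod_cast h1
    have := Real.log_le_log (by linarith : (0 : ℝ) < n) (by linarith : (n : ℝ) ≤ n + 1)
    exact ⟨by linarith, log_succ_sub_log_le (by linarith)⟩
  have hub : ∀ n : ℕ, d ≤ n → n ≤ Y → |u n| ≤ 2 * L / d := by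
    intro n h1 h2
    have h3 : (d : ℝ) ≤ n := by exact_mod_cast h1
    have a1 := hα n h1
    have a2 := hlog n h1 (by omega)
    have a3 := hlog (n + 1) (by omega) (by omega)
    push_cast at a3
    rw [hfac, abs_neg, abs_of_nonneg (mul_nonneg a1.1 (by linarith))]
    have a4 : 1 / (n : ℝ) ≤ 1 / d := one_div_le_one_div_of_le (by linarith) h3
    calc _ ≤ 1 / (d : ℝ) * (2 * L) := by
          refine mul_le_mul (by linarith) (by linarith) (by linarith) (by positivity)
      _ = _ := by ring
  have hvar : ∀ n : ℕ, d ≤ n → n < Y → |u n - u (n + 1)| ≤ (2 + 2 * L) * (1 / (n : ℝ) ^ 2) := by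
    intro n h1 h2
    have h3 : (d : ℝ) ≤ n := by exact_mod_cast h1
    have hn0 : (0 : ℝ) < n := by linarith
    have a1 := hα n h1
    have a1' := hα (n + 1) (by omega)
    have a2 := hlog n h1 (by omega)
    have a3 := hlog (n + 1) (by omega) (by omega)
    push_cast at a3 a1'
    set α := Real.log (n + 1) - Real.log n with hαd
    set α' := Real.log (n + 1 + 1) - Real.log (n + 1) with hαd'
    have a5 : 1 / ((n : ℝ) + 1) ≤ 1 / n := one_div_le_one_div_of_le hn0 (by linarith)
    -- `α - α' = log ((n+1)² / (n(n+2)))`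
    have a6 : 0 ≤ α - α' ∧ α - α' ≤ 1 / (n : ℝ) ^ 2 := by
      have q : α - α' = Real.log ((n + 1) ^ 2 / (n * (n + 2))) := by
        rw [Real.log_div (by positivity) (by positivity), Real.log_pow,
          Real.log_mul (by positivity) (by positivity), hαd, hαd',
          show (n : ℝ) + 1 + 1 = n + 2 by ring]
        push_cast; ring
      rw [q]
      constructor
      · apply Real.log_nonneg
        rw [le_div_iff₀ (by positivity)]; nlinarith
      · refine (Real.log_le_sub_one_of_pos (by positivity)).trans ?_
        rw [div_sub_one (by positivity), div_le_div_iff₀ (by positivity) (by positivity)]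
        nlinarith
    have q : u n - u (n + 1) = α' * (α + α') -
        (α - α') * ((Real.log (n + 1) - Real.log d) + (Real.log n - Real.log d)) := by
      rw [hfac, hfac]; push_cast; rw [hαd, hαd']; ring
    rw [q]
    refine (abs_sub _ _).trans ?_
    rw [abs_of_nonneg (mul_nonneg a1'.1 (by linarith)), abs_of_nonneg (mul_nonneg a6.1 (by linarith))]
    have c1 : α' * (α + α') ≤ (1 / n) * (2 * (1 / n)) :=
      mul_le_mul (by linarith) (by linarith) (by linarith) (by positivity)
    have c2 : (α - α') * ((Real.log (n + 1) - Real.log d) + (Real.log n - Real.log d)) ≤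
        1 / (n : ℝ) ^ 2 * (2 * L) := mul_le_mul a6.2 (by linarith) (by linarith) (by positivity)
    have c3 : (1 / (n : ℝ)) * (2 * (1 / n)) = 2 * (1 / (n : ℝ) ^ 2) := by field_simp
    linarith
  have hsum : ∑ n ∈ Finset.Ico d Y, |u n - u (n + 1)| ≤ (2 + 2 * L) * (2 / d) := by
    refine (Finset.sum_le_sum fun n hn =>
      hvar n (Finset.mem_Ico.1 hn).1 (Finset.mem_Ico.1 hn).2).trans ?_
    rw [← Finset.mul_sum]
    refine mul_le_mul_of_nonneg_left ((sum_one_div_sq_le hd hdY).trans ?_) (by linarith)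
    have : 0 ≤ 2 / (Y : ℝ) := by positivity
    linarith
  have hfin := abs_sum_chi_mul_le u hdY
  have h1 := hub d le_rfl hdY
  have h2 := hub Y hdY le_rfl
  rw [e3, abs_mul, abs_of_pos (by norm_num : (0 : ℝ) < 1 / 2)]
  have : (2 * L + 1) / d = 1 / 4 * (2 * L / d + 2 * L / d + (2 + 2 * L) * (2 / d)) := by ring
  rw [this]
  linarith

/-! ### The hyperbola method for the alternating zeta coefficients -/

/-- The Dirichlet hyperbola method for a symmetric summand, folded along the diagonal. -/
lemma sum_hyperbola_of_symm (W : ℕ → ℕ → ℝ) (hW : ∀ d e, W d e = W e d) (N : ℕ) :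
    ∑ x ∈ Finset.Ioc 0 N ×ˢ Finset.Ioc 0 N with x.1 * x.2 ≤ N, W x.1 x.2 =
      ∑ d ∈ Finset.Ico 1 (N.sqrt + 1),
        (W d d + 2 * ∑ e ∈ Finset.Ico (d + 1) (N / d + 1), W d e) := by
  set H := (Finset.Ioc 0 N ×ˢ Finset.Ioc 0 N).filter (fun x => x.1 * x.2 ≤ N) with hH
  have hmem : ∀ x : ℕ × ℕ, x ∈ H ↔ 1 ≤ x.1 ∧ 1 ≤ x.2 ∧ x.1 * x.2 ≤ N := by
    intro x
    rw [hH, Finset.mem_filter, Finset.mem_product, Finset.mem_Ioc, Finset.mem_Ioc]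
    constructor
    · rintro ⟨⟨h1, h2⟩, h3⟩; exact ⟨h1.1, h2.1, h3⟩
    · rintro ⟨h1, h2, h3⟩
      exact ⟨⟨⟨h1, (Nat.le_mul_of_pos_right _ h2).trans h3⟩,
        ⟨h2, (Nat.le_mul_of_pos_left _ h1).trans h3⟩⟩, h3⟩
  have hlt : ∑ x ∈ H with x.1 < x.2, W x.1 x.2 =
      ∑ d ∈ Finset.Ico 1 (N.sqrt + 1), ∑ e ∈ Finset.Ico (d + 1) (N / d + 1), W d e := by
    rw [Finset.sum_sigma']
    refine Finset.sum_bij' (fun x _ => ⟨x.1, x.2⟩) (fun x _ => (x.1, x.2)) ?_ ?_ ?_ ?_ ?_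
    · intro x hx
      rw [Finset.mem_filter, hmem] at hx
      obtain ⟨⟨h1, h2, h3⟩, h4⟩ := hx
      rw [Finset.mem_sigma, Finset.mem_Ico, Finset.mem_Ico]
      refine ⟨⟨h1, Nat.lt_succ_of_le (Nat.le_sqrt.2 ?_)⟩, h4, Nat.lt_succ_of_le ?_⟩
      · exact (Nat.mul_le_mul_left _ h4.le).trans h3
      · rw [Nat.le_div_iff_mul_le h1, mul_comm]; exact h3
    · rintro ⟨d, e⟩ hx
      rw [Finset.mem_sigma, Finset.mem_Ico, Finset.mem_Ico] at hx
      obtain ⟨⟨h1, h2⟩, h3, h4⟩ := hx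
      simp only at h1 h2 h3 h4
      rw [Finset.mem_filter, hmem]
      refine ⟨⟨h1, by simp only; omega, ?_⟩, by simp only; omega⟩
      have := (Nat.le_div_iff_mul_le h1).1 (Nat.le_of_lt_succ h4)
      simp only
      rwa [mul_comm]
    · intro x _; rfl
    · intro x _; rfl
    · intro x _; rfl
  have hgt : ∑ x ∈ H with x.2 < x.1, W x.1 x.2 = ∑ x ∈ H with x.1 < x.2, W x.1 x.2 := by
    refine Finset.sum_bij' (fun x _ => x.swap) (fun x _ => x.swap) ?_ ?_ ?_ ?_ ?_
    · intro x hx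
      rw [Finset.mem_filter, hmem] at hx ⊢
      exact ⟨⟨hx.1.2.1, hx.1.1, by rw [Prod.fst_swap, Prod.snd_swap, mul_comm]; exact hx.1.2.2⟩, hx.2⟩
    · intro x hx
      rw [Finset.mem_filter, hmem] at hx ⊢
      exact ⟨⟨hx.1.2.1, hx.1.1, by rw [Prod.fst_swap, Prod.snd_swap, mul_comm]; exact hx.1.2.2⟩, hx.2⟩
    · intro x _; rfl
    · intro x _; rfl
    · intro x _; exact hW _ _
  have heq : ∑ x ∈ H with x.1 = x.2, W x.1 x.2 = ∑ d ∈ Finset.Ico 1 (N.sqrt + 1), W d d := by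
    refine Finset.sum_bij' (fun x _ => x.1) (fun d _ => (d, d)) ?_ ?_ ?_ ?_ ?_
    · intro x hx
      rw [Finset.mem_filter, hmem] at hx
      rw [Finset.mem_Ico]
      refine ⟨hx.1.1, Nat.lt_succ_of_le (Nat.le_sqrt.2 ?_)⟩
      have := hx.1.2.2
      rwa [← hx.2] at this
    · intro d hd
      rw [Finset.mem_Ico] at hd
      rw [Finset.mem_filter, hmem]
      exact ⟨⟨hd.1, hd.1, Nat.le_sqrt.1 (Nat.le_of_lt_succ hd.2)⟩, rfl⟩
    · intro x hx
      rw [Finset.mem_filter] at hx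
      exact Prod.ext rfl hx.2
    · intro x _; rfl
    · intro x hx
      rw [Finset.mem_filter] at hx
      rw [← hx.2]
  clear_value H
  have hne : ∑ x ∈ H with ¬ x.1 = x.2, W x.1 x.2 =
      ∑ x ∈ H with x.1 < x.2, W x.1 x.2 + ∑ x ∈ H with x.2 < x.1, W x.1 x.2 := by
    rw [← Finset.sum_filter_add_sum_filter_not (H.filter (fun x => ¬ x.1 = x.2))
      (fun x => x.1 < x.2)]
    congr 1
    · refine Finset.sum_congr (Finset.ext fun x => ?_) fun _ _ => rfl
      rw [Finset.mem_filter, Finset.mem_filter, Finset.mem_filter, and_assoc, and_congr_right_iff]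
      omega
    · refine Finset.sum_congr (Finset.ext fun x => ?_) fun _ _ => rfl
      rw [Finset.mem_filter, Finset.mem_filter, Finset.mem_filter, and_assoc, and_congr_right_iff]
      omega
  rw [← Finset.sum_filter_add_sum_filter_not H (fun x => x.1 = x.2), hne, hgt, heq, hlt,
    Finset.sum_add_distrib, ← Finset.mul_sum]
  ring

/-- The arithmetic function `1, -1, 1, -1, …` with Dirichlet series `(1 - 2^{1-s}) ζ(s)`. -/
noncomputable def eta : ArithmeticFunction ℝ :=
  ⟨fun n => if n = 0 then 0 else chi n, if_pos rfl⟩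

/-- The derivation `f ↦ f · log` of the Dirichlet ring, which is `-d/ds` on Dirichlet series. -/
noncomputable def logMulAF (f : ArithmeticFunction ℝ) : ArithmeticFunction ℝ :=
  ArithmeticFunction.log.pmul f

lemma eta_apply {n : ℕ} (hn : 1 ≤ n) : eta n = chi n := if_neg (by omega)

lemma logMulAF_apply (f : ArithmeticFunction ℝ) (n : ℕ) : logMulAF f n = Real.log n * f n := rfl

/-- `η D²η - (Dη)²`, where `D` is multiplication by `log`. -/
noncomputable def etaWronskian : ArithmeticFunction ℝ :=
  eta * logMulAF (logMulAF eta) - logMulAF eta * logMulAF eta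

lemma sub_af_apply (f g : ArithmeticFunction ℝ) (n : ℕ) : (f - g) n = f n - g n := rfl

/-- The inner sum over `d < e ≤ N/d` of `χ(d) χ(e)` is `(χ(d) χ(⌊N/d⌋) - 1) / 2`, and the `-1`
cancels against the diagonal. -/
lemma sum_eta_mul_eta (N : ℕ) : ∑ n ∈ Finset.Ioc 0 N, (eta * eta) n =
    ∑ d ∈ Finset.Ico 1 (N.sqrt + 1), chi d * chi (N / d) := by
  rw [ArithmeticFunction.sum_Ioc_mul_eq_sum_prod_filter]
  rw [sum_hyperbola_of_symm (fun d e => eta d * eta e) (fun d e => mul_comm _ _)]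
  refine Finset.sum_congr rfl fun d hd => ?_
  rw [Finset.mem_Ico] at hd
  have hsq := Nat.le_sqrt.1 (Nat.le_of_lt_succ hd.2)
  have hdY : d ≤ N / d := (Nat.le_div_iff_mul_le hd.1).2 hsq
  have h1 : ∑ e ∈ Finset.Ico (d + 1) (N / d + 1), eta d * eta e =
      chi d * ∑ e ∈ Finset.Ico (d + 1) (N / d + 1), chi e * (1 : ℝ) := by
    rw [Finset.mul_sum]
    refine Finset.sum_congr rfl fun e he => ?_
    rw [Finset.mem_Ico] at he
    rw [eta_apply hd.1, eta_apply (by omega), mul_one]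
  have h2 := two_mul_sum_chi_mul (fun _ => 1) (by omega : d + 1 ≤ N / d + 1)
  simp only [sub_self, mul_zero, Finset.sum_const_zero, chi_succ, add_zero] at h2
  rw [h1, eta_apply hd.1, mul_left_comm, h2]
  ring

/-- Symmetrised, the summand is `½ χ(d) χ(e) log²(e/d)`, which vanishes on the diagonal. -/
lemma sum_etaWronskian (N : ℕ) : ∑ n ∈ Finset.Ioc 0 N, etaWronskian n =
    ∑ d ∈ Finset.Ico 1 (N.sqrt + 1), chi d *
      ∑ e ∈ Finset.Ico (d + 1) (N / d + 1), chi e * (Real.log e - Real.log d) ^ 2 := by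
  set H := (Finset.Ioc 0 N ×ˢ Finset.Ioc 0 N).filter (fun x => x.1 * x.2 ≤ N) with hH
  have h1 : ∑ n ∈ Finset.Ioc 0 N, etaWronskian n = ∑ x ∈ H,
      (eta x.1 * eta x.2 * Real.log x.2 ^ 2 -
        eta x.1 * eta x.2 * (Real.log x.1 * Real.log x.2)) := by
    simp only [etaWronskian, sub_af_apply, Finset.sum_sub_distrib]
    rw [ArithmeticFunction.sum_Ioc_mul_eq_sum_prod_filter,
      ArithmeticFunction.sum_Ioc_mul_eq_sum_prod_filter]
    simp only [logMulAF_apply]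
    congr 1
    · exact Finset.sum_congr rfl fun x _ => by ring
    · exact Finset.sum_congr rfl fun x _ => by ring
  have hswap : ∑ x ∈ H, eta x.1 * eta x.2 * Real.log x.2 ^ 2 =
      ∑ x ∈ H, eta x.1 * eta x.2 * Real.log x.1 ^ 2 := by
    refine Finset.sum_bij' (fun x _ => x.swap) (fun x _ => x.swap) ?_ ?_ ?_ ?_ ?_
    · intro x hx
      rw [hH, Finset.mem_filter, Finset.mem_product] at hx ⊢
      exact ⟨⟨hx.1.2, hx.1.1⟩, by rw [Prod.fst_swap, Prod.snd_swap, mul_comm]; exact hx.2⟩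
    · intro x hx
      rw [hH, Finset.mem_filter, Finset.mem_product] at hx ⊢
      exact ⟨⟨hx.1.2, hx.1.1⟩, by rw [Prod.fst_swap, Prod.snd_swap, mul_comm]; exact hx.2⟩
    · intro x _; rfl
    · intro x _; rfl
    · intro x _; simp only [Prod.fst_swap, Prod.snd_swap]; ring
  have h2 : ∑ n ∈ Finset.Ioc 0 N, etaWronskian n =
      1 / 2 * ∑ x ∈ H, eta x.1 * eta x.2 * (Real.log x.2 - Real.log x.1) ^ 2 := by
    have h3 : ∑ x ∈ H, eta x.1 * eta x.2 * (Real.log x.2 - Real.log x.1) ^ 2 =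
        ∑ x ∈ H, eta x.1 * eta x.2 * Real.log x.2 ^ 2 +
        ∑ x ∈ H, eta x.1 * eta x.2 * Real.log x.1 ^ 2 -
        2 * ∑ x ∈ H, eta x.1 * eta x.2 * (Real.log x.1 * Real.log x.2) := by
      rw [Finset.mul_sum, ← Finset.sum_add_distrib, ← Finset.sum_sub_distrib]
      exact Finset.sum_congr rfl fun x _ => by ring
    rw [h1, h3, Finset.sum_sub_distrib, ← hswap]
    ring
  rw [h2, hH, sum_hyperbola_of_symm
    (fun d e => eta d * eta e * (Real.log e - Real.log d) ^ 2) (fun d e => by ring),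
    Finset.mul_sum]
  refine Finset.sum_congr rfl fun d hd => ?_
  rw [Finset.mem_Ico] at hd
  have h4 : ∑ e ∈ Finset.Ico (d + 1) (N / d + 1), eta d * eta e * (Real.log e - Real.log d) ^ 2 =
      chi d * ∑ e ∈ Finset.Ico (d + 1) (N / d + 1), chi e * (Real.log e - Real.log d) ^ 2 := by
    rw [Finset.mul_sum]
    refine Finset.sum_congr rfl fun e he => ?_
    rw [Finset.mem_Ico] at he
    rw [eta_apply hd.1, eta_apply (by omega), mul_assoc]
  rw [h4]
  ring

lemma exists_log_add_one_le {ε : ℝ} (h0 : 0 < ε) :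
    ∃ K : ℝ, 0 ≤ K ∧ ∀ N : ℕ, 1 ≤ N → 1 + Real.log (N + 2) ≤ K * (N : ℝ) ^ ε := by
  refine ⟨1 + 3 ^ ε / ε, by positivity, fun N hN => ?_⟩
  have hN1 : (1 : ℝ) ≤ N := by exact_mod_cast hN
  have h1 : Real.log (N + 2) ≤ (N + 2 : ℝ) ^ ε / ε := Real.log_le_rpow_div (by linarith) h0
  have h2 : (N + 2 : ℝ) ^ ε ≤ 3 ^ ε * (N : ℝ) ^ ε := by
    rw [← Real.mul_rpow (by norm_num) (by positivity)]
    exact Real.rpow_le_rpow (by positivity) (by linarith) h0.le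
  have h3 : 1 ≤ (N : ℝ) ^ ε := Real.one_le_rpow hN1 h0.le
  have h4 : (N + 2 : ℝ) ^ ε / ε ≤ 3 ^ ε * (N : ℝ) ^ ε / ε := by gcongr
  have h5 : (1 + 3 ^ ε / ε) * (N : ℝ) ^ ε = (N : ℝ) ^ ε + 3 ^ ε * (N : ℝ) ^ ε / ε := by ring
  linarith

lemma sum_one_div_le_one_add_log (r : ℕ) :
    ∑ d ∈ Finset.Ico 1 (r + 1), 1 / (d : ℝ) ≤ 1 + Real.log r := by
  have h := harmonic_le_one_add_log r
  rw [harmonic_eq_sum_Icc] at h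
  push_cast at h
  simpa [Finset.Ico_add_one_right_eq_Icc] using h

/-- The summatory function of `η D²η - (Dη)²`. -/
theorem exists_abs_sum_etaWronskian_le {ε : ℝ} (h0 : 0 < ε) :
    ∃ K : ℝ, 0 ≤ K ∧ ∀ N : ℕ, 1 ≤ N →
      |∑ n ∈ Finset.Ioc 0 N, etaWronskian n| ≤ K * (N : ℝ) ^ (1 / 3 + ε) := by
  obtain ⟨K, hK0, hK⟩ := exists_abs_sum_chi_mul_chi_div_le (half_pos h0)
  obtain ⟨J, hJ0, hJ⟩ := exists_log_add_one_le (ε := ε / 4) (by linarith)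
  refine ⟨(K + 2) * J ^ 2, by positivity, fun N hN => ?_⟩
  have hN1 : (1 : ℝ) ≤ N := by exact_mod_cast hN
  have hN0 : (0 : ℝ) < N := by linarith
  have hJ := hJ N hN
  set L := Real.log (N + 2) with hL
  have hL0 : 0 ≤ L := Real.log_nonneg (by linarith)
  set r := N.sqrt with hr
  have hr1 : 1 ≤ r := Nat.le_sqrt.2 (by omega)
  have hdr : ∀ d, 1 ≤ d → d ≤ r → d ≤ N / d := fun d h1 h2 =>
    (Nat.le_div_iff_mul_le h1).2 (Nat.le_sqrt.1 h2)
  set w : ℕ → ℝ := fun d => (Real.log (N / d : ℕ) - Real.log d) ^ 2 with hw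
  have hwb : ∀ d, 1 ≤ d → d ≤ r → 0 ≤ Real.log (N / d : ℕ) - Real.log d := by
    intro d h1 h2
    have : (d : ℝ) ≤ ((N / d : ℕ) : ℝ) := by exact_mod_cast hdr d h1 h2
    have := Real.log_le_log (by exact_mod_cast h1) this
    linarith
  have hmain : |∑ d ∈ Finset.Ico 1 (r + 1), (chi d * chi (N / d)) * w d| ≤
      K * (N : ℝ) ^ (1 / 3 + ε / 2) * w 1 := by
    refine abs_sum_mul_le_of_antitone _ w r (fun D hD => hK N hN D ?_) (fun d h1 h2 => ?_)
      (fun d _ _ => sq_nonneg _) hr1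
    · rw [sq]; exact Nat.le_sqrt.1 hD
    · have a1 := hwb (d + 1) (by omega) h2
      have a2 : ((N / (d + 1) : ℕ) : ℝ) ≤ ((N / d : ℕ) : ℝ) := by
        exact_mod_cast Nat.div_le_div_left (by omega) (by omega)
      have a3 : (1 : ℝ) ≤ ((N / (d + 1) : ℕ) : ℝ) := by
        exact_mod_cast (by omega : 1 ≤ d + 1).trans (hdr (d + 1) (by omega) h2)
      have a4 := Real.log_le_log (by linarith) a2
      have a5 := Real.log_le_log (by exact_mod_cast h1 : (0 : ℝ) < d)
        (by push_cast; linarith : (d : ℝ) ≤ ((d + 1 : ℕ) : ℝ))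
      exact pow_le_pow_left₀ a1 (by linarith) 2
  have hw1 : w 1 ≤ (1 + L) ^ 2 := by
    simp only [hw, Nat.div_one, Nat.cast_one, Real.log_one, sub_zero]
    have := Real.log_le_log hN0 (by linarith : (N : ℝ) ≤ N + 2)
    exact pow_le_pow_left₀ (Real.log_nonneg hN1) (by linarith) 2
  have herr : |∑ d ∈ Finset.Ico 1 (r + 1), chi d *
      ∑ e ∈ Finset.Ico (d + 1) (N / d + 1), chi e * (Real.log e - Real.log d) ^ 2 -
      1 / 2 * ∑ d ∈ Finset.Ico 1 (r + 1), (chi d * chi (N / d)) * w d| ≤ 2 * (1 + L) ^ 2 := by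
    rw [Finset.mul_sum, ← Finset.sum_sub_distrib]
    refine (Finset.abs_sum_le_sum_abs _ _).trans ?_
    have hterm : ∀ d ∈ Finset.Ico 1 (r + 1), |chi d *
        ∑ e ∈ Finset.Ico (d + 1) (N / d + 1), chi e * (Real.log e - Real.log d) ^ 2 -
        1 / 2 * ((chi d * chi (N / d)) * w d)| ≤ (2 * L + 1) * (1 / d) := by
      intro d hd
      rw [Finset.mem_Ico] at hd
      have h1 := abs_sum_chi_mul_log_sq_sub_le hd.1 (hdr d hd.1 (by omega)) (Nat.div_le_self N d)
      rw [show ∀ S : ℝ, chi d * S - 1 / 2 * ((chi d * chi (N / d)) * w d) =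
        chi d * (S - 1 / 2 * chi (N / d) * w d) by intro S; ring, abs_mul, abs_chi, one_mul,
        mul_one_div]
      exact h1
    refine (Finset.sum_le_sum hterm).trans ?_
    rw [← Finset.mul_sum]
    have h1 := sum_one_div_le_one_add_log r
    have h2 : Real.log r ≤ L := Real.log_le_log (by exact_mod_cast hr1) (by
      have : (r : ℝ) ≤ N := by exact_mod_cast Nat.sqrt_le_self N
      linarith)
    calc (2 * L + 1) * ∑ d ∈ Finset.Ico 1 (r + 1), 1 / (d : ℝ) ≤ (2 * L + 1) * (1 + L) :=
          mul_le_mul_of_nonneg_left (by linarith) (by linarith)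
      _ ≤ 2 * (1 + L) ^ 2 := by nlinarith
  rw [sum_etaWronskian]
  have hJ2 : (1 + L) ^ 2 ≤ J ^ 2 * (N : ℝ) ^ (ε / 2) := by
    calc (1 + L) ^ 2 ≤ (J * (N : ℝ) ^ (ε / 4)) ^ 2 := pow_le_pow_left₀ (by linarith) hJ 2
      _ = J ^ 2 * ((N : ℝ) ^ (ε / 4)) ^ 2 := by ring
      _ = _ := by
        rw [← Real.rpow_natCast ((N : ℝ) ^ (ε / 4)), ← Real.rpow_mul hN0.le]
        congr 2; push_cast; ring
  have hNp : 1 ≤ (N : ℝ) ^ (1 / 3 + ε / 2) := Real.one_le_rpow hN1 (by linarith)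
  have hmul : (N : ℝ) ^ (1 / 3 + ε / 2) * (N : ℝ) ^ (ε / 2) = (N : ℝ) ^ (1 / 3 + ε) := by
    rw [← Real.rpow_add hN0]; congr 1; ring
  have f1 := abs_le.1 herr
  have f2 := abs_le.1 hmain
  have f3 : K * (N : ℝ) ^ (1 / 3 + ε / 2) * w 1 ≤ K * J ^ 2 * (N : ℝ) ^ (1 / 3 + ε) := by
    calc K * (N : ℝ) ^ (1 / 3 + ε / 2) * w 1 ≤
          K * (N : ℝ) ^ (1 / 3 + ε / 2) * (J ^ 2 * (N : ℝ) ^ (ε / 2)) := by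
          gcongr
          exact hw1.trans hJ2
      _ = _ := by rw [← hmul]; ring
  have f4 : (1 + L) ^ 2 ≤ J ^ 2 * (N : ℝ) ^ (1 / 3 + ε) := by
    refine hJ2.trans (mul_le_mul_of_nonneg_left ?_ (by positivity))
    exact Real.rpow_le_rpow_of_exponent_le hN1 (by linarith)
  have f5 : 0 ≤ K * J ^ 2 * (N : ℝ) ^ (1 / 3 + ε) := by positivity
  rw [abs_le]
  constructor <;> nlinarith [f1.1, f1.2, f2.1, f2.2]

/-! ### The ring of arithmetic functions and the coefficients `b` -/

lemma logMulAF_add (f g : ArithmeticFunction ℝ) :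
    logMulAF (f + g) = logMulAF f + logMulAF g := by
  ext n; simp only [logMulAF_apply, ArithmeticFunction.add_apply]; ring

lemma logMulAF_sub (f g : ArithmeticFunction ℝ) :
    logMulAF (f - g) = logMulAF f - logMulAF g := by
  ext n; simp only [logMulAF_apply, sub_af_apply]; ring

lemma logMulAF_mul (f g : ArithmeticFunction ℝ) :
    logMulAF (f * g) = logMulAF f * g + f * logMulAF g := by
  ext n
  simp only [logMulAF_apply, ArithmeticFunction.add_apply, ArithmeticFunction.mul_apply]
  rw [Finset.mul_sum, ← Finset.sum_add_distrib]
  refine Finset.sum_congr rfl fun x hx => ?_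
  rw [Nat.mem_divisorsAntidiagonal] at hx
  have h1 : (x.1 : ℝ) ≠ 0 := by
    intro h; rw [Nat.cast_eq_zero] at h; rw [h, zero_mul] at hx; exact hx.2 hx.1.symm
  have h2 : (x.2 : ℝ) ≠ 0 := by
    intro h; rw [Nat.cast_eq_zero] at h; rw [h, mul_zero] at hx; exact hx.2 hx.1.symm
  rw [← hx.1, Nat.cast_mul, Real.log_mul h1 h2]
  ring

/-- The arithmetic function supported at `2` with Dirichlet series `2^{-s}`. -/
noncomputable def atTwo : ArithmeticFunction ℝ := ⟨fun n => if n = 2 then 1 else 0, by simp⟩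

lemma atTwo_apply (n : ℕ) : atTwo n = if n = 2 then 1 else 0 := rfl

/-- The real-valued constant function `1` of the Dirichlet ring. -/
noncomputable def zetaAF : ArithmeticFunction ℝ :=
  ((ArithmeticFunction.zeta : ArithmeticFunction ℕ) : ArithmeticFunction ℝ)

lemma zetaAF_apply {n : ℕ} (hn : n ≠ 0) : zetaAF n = 1 := by
  rw [zetaAF, ArithmeticFunction.natCoe_apply, ArithmeticFunction.zeta_apply_ne hn, Nat.cast_one]

lemma atTwo_mul_apply (f : ArithmeticFunction ℝ) (n : ℕ) :
    (atTwo * f) n = if 2 ∣ n then f (n / 2) else 0 := by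
  rcases Nat.eq_zero_or_pos n with rfl | hn
  · simp
  rw [ArithmeticFunction.mul_apply,
    Nat.sum_divisorsAntidiagonal (f := fun i j => atTwo i * f j)]
  split_ifs with h
  · rw [Finset.sum_eq_single 2]
    · rw [atTwo_apply, if_pos rfl, one_mul]
    · intro d _ hd; rw [atTwo_apply, if_neg hd, zero_mul]
    · intro h2; exact absurd (Nat.mem_divisors.2 ⟨h, hn.ne'⟩) h2
  · refine Finset.sum_eq_zero fun d hd => ?_
    rw [atTwo_apply, if_neg, zero_mul]
    rintro rfl
    exact h (Nat.dvd_of_mem_divisors hd)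

lemma atTwo_pow_mul_apply (f : ArithmeticFunction ℝ) (m n : ℕ) :
    (atTwo ^ m * f) n = if 2 ^ m ∣ n then f (n / 2 ^ m) else 0 := by
  induction m generalizing n with
  | zero => simp
  | succ m ih =>
    rw [pow_succ', mul_assoc, atTwo_mul_apply, ih, Nat.div_div_eq_div_mul, ← pow_succ']
    by_cases h2 : 2 ∣ n
    · rw [if_pos h2]
      obtain ⟨k, rfl⟩ := h2
      rw [Nat.mul_div_cancel_left _ (by norm_num), pow_succ']
      exact if_congr (Nat.mul_dvd_mul_iff_left (by norm_num)).symm rfl rfl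
    · rw [if_neg h2, if_neg]
      exact fun h => h2 ((Dvd.intro_left _ (pow_succ 2 m).symm).trans h)

lemma nsmul_af_apply (k : ℕ) (f : ArithmeticFunction ℝ) (n : ℕ) : (k • f) n = k * f n := by
  induction k with
  | zero => simp
  | succ k ih => rw [succ_nsmul, ArithmeticFunction.add_apply, ih]; push_cast; ring

/-- `ζ D²ζ - (Dζ)²`, where `D` is multiplication by `log`. -/
noncomputable def zetaWronskian : ArithmeticFunction ℝ :=
  zetaAF * logMulAF (logMulAF zetaAF) - logMulAF zetaAF * logMulAF zetaAF

/-- The arithmetic function with Dirichlet series `1 - 2^{1-s}`. -/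
noncomputable def gammaAF : ArithmeticFunction ℝ := 1 - (atTwo + atTwo)

lemma zetaWronskian_apply (n : ℕ) : zetaWronskian n = a n := by
  rw [zetaWronskian, mul_comm zetaAF, sub_af_apply, ArithmeticFunction.mul_apply,
    ArithmeticFunction.mul_apply,
    Nat.sum_divisorsAntidiagonal (f := fun i j => logMulAF (logMulAF zetaAF) i * zetaAF j),
    Nat.sum_divisorsAntidiagonal (f := fun i j => logMulAF zetaAF i * logMulAF zetaAF j),
    ← Finset.sum_sub_distrib, a]
  refine Finset.sum_congr rfl fun d hd => ?_
  have h1 := (Nat.pos_of_mem_divisors hd).ne'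
  have h2 : n / d ≠ 0 := (Nat.div_pos (Nat.divisor_le hd) (Nat.pos_of_mem_divisors hd)).ne'
  simp only [logMulAF_apply, zetaAF_apply h1, zetaAF_apply h2]
  ring

lemma gammaAF_pow_mul_zetaWronskian_apply (n : ℕ) : (gammaAF ^ 4 * zetaWronskian) n = b n := by
  have h : gammaAF ^ 4 * zetaWronskian = atTwo ^ 0 * zetaWronskian - 8 • (atTwo ^ 1 * zetaWronskian)
      + 24 • (atTwo ^ 2 * zetaWronskian) - 32 • (atTwo ^ 3 * zetaWronskian)
      + 16 • (atTwo ^ 4 * zetaWronskian) := by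
    simp only [gammaAF, nsmul_eq_mul]; push_cast; ring
  rw [h]
  simp only [sub_af_apply, ArithmeticFunction.add_apply, nsmul_af_apply, atTwo_pow_mul_apply,
    zetaWronskian_apply, b, Finset.sum_range_succ, Finset.sum_range_zero]
  have c2 : Nat.choose 4 2 = 6 := rfl
  have c3 : Nat.choose 4 3 = 4 := rfl
  simp only [Nat.choose_zero_right, Nat.choose_one_right, c2, c3, Nat.choose_self]
  push_cast
  split_ifs <;> ring

/-- `η(s) = (1 - 2^{1-s}) ζ(s)` on coefficients. -/
lemma eta_eq : eta = gammaAF * zetaAF := by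
  have h : gammaAF * zetaAF = zetaAF - 2 • (atTwo * zetaAF) := by
    simp only [gammaAF, nsmul_eq_mul]; push_cast; ring
  rw [h]
  ext n
  rw [sub_af_apply, nsmul_af_apply, atTwo_mul_apply]
  rcases Nat.eq_zero_or_pos n with rfl | hn
  · simp
  rw [eta_apply hn, zetaAF_apply hn.ne']
  obtain ⟨q, rfl | rfl⟩ := Nat.even_or_odd' n
  · rw [if_pos (Dvd.intro _ rfl), Nat.mul_div_cancel_left _ (by norm_num), zetaAF_apply (by omega),
      chi_two_mul]
    norm_num
  · rw [if_neg (by omega), chi_succ, chi_two_mul]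
    norm_num

lemma logMulAF_one : logMulAF 1 = 0 := by
  ext n
  rw [logMulAF_apply, ArithmeticFunction.one_apply]
  split_ifs with h <;> simp [h]

lemma logMulAF_logMulAF_atTwo_mul_apply (f : ArithmeticFunction ℝ) (n : ℕ) :
    (logMulAF (logMulAF atTwo) * f) n = Real.log 2 ^ 2 * (atTwo * f) n := by
  rw [ArithmeticFunction.mul_apply, ArithmeticFunction.mul_apply, Finset.mul_sum]
  refine Finset.sum_congr rfl fun x _ => ?_
  rw [logMulAF_apply, logMulAF_apply, atTwo_apply]
  split_ifs with h
  · rw [h]; push_cast; ring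
  · ring

lemma atTwo_mul_logMulAF_logMulAF :
    atTwo * logMulAF (logMulAF atTwo) = logMulAF atTwo * logMulAF atTwo := by
  ext n
  rw [ArithmeticFunction.mul_apply, ArithmeticFunction.mul_apply]
  refine Finset.sum_congr rfl fun x _ => ?_
  simp only [logMulAF_apply, atTwo_apply]
  split_ifs with h1 h2
  · rw [h1, h2]; ring
  all_goals ring

/-- Since `(log η)'' = (log γ)'' + (log ζ)''` for `η = γ ζ`, the function `γ⁴ (ζ ζ'' - ζ'²)` is a
polynomial in `γ`, `2^{-s}`, `η²` and `η η'' - η'²`, so that no pole is left. -/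
lemma gammaAF_pow_mul_zetaWronskian : gammaAF ^ 4 * zetaWronskian =
    gammaAF ^ 2 * etaWronskian + 2 • (logMulAF (logMulAF atTwo) * (eta * eta)) := by
  rw [etaWronskian, zetaWronskian, eta_eq, nsmul_eq_mul]
  have hg : logMulAF gammaAF = -(logMulAF atTwo + logMulAF atTwo) := by
    rw [gammaAF, logMulAF_sub, logMulAF_add, logMulAF_one, zero_sub]
  have hg2 : logMulAF (logMulAF gammaAF) =
      -(logMulAF (logMulAF atTwo) + logMulAF (logMulAF atTwo)) := by
    have h0 : logMulAF 0 = 0 := by ext n; simp [logMulAF_apply]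
    rw [hg, ← zero_sub, logMulAF_sub, logMulAF_add, h0, zero_sub]
  rw [logMulAF_mul, logMulAF_add, logMulAF_mul, logMulAF_mul, hg2, hg, gammaAF]
  have h := atTwo_mul_logMulAF_logMulAF
  generalize logMulAF (logMulAF atTwo) = t2 at *
  generalize logMulAF atTwo = t1 at *
  generalize logMulAF (logMulAF zetaAF) = z2 at *
  generalize logMulAF zetaAF = z1 at *
  generalize zetaAF = z at *
  generalize atTwo = t at *
  push_cast
  linear_combination (-4 * (1 - 2 * t) ^ 2 * z ^ 2) * h

lemma sum_atTwo_mul (f : ArithmeticFunction ℝ) (N : ℕ) :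
    ∑ n ∈ Finset.Ioc 0 N, (atTwo * f) n = ∑ n ∈ Finset.Ioc 0 (N / 2), f n := by
  rw [ArithmeticFunction.sum_Ioc_mul_eq_sum_sum]
  rcases lt_or_ge N 2 with h | h
  · rw [show N / 2 = 0 by omega]
    simp only [Finset.Ioc_self, Finset.sum_empty]
    refine Finset.sum_eq_zero fun n hn => ?_
    rw [Finset.mem_Ioc] at hn
    rw [atTwo_apply, if_neg (by omega), zero_mul]
  · rw [Finset.sum_eq_single 2]
    · rw [atTwo_apply, if_pos rfl, one_mul]
    · intro d _ hd; rw [atTwo_apply, if_neg hd, zero_mul]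
    · intro h2; exact absurd (Finset.mem_Ioc.2 ⟨by norm_num, h⟩) h2

lemma sum_b (N : ℕ) : ∑ n ∈ Finset.Ioc 0 N, b n =
    ∑ n ∈ Finset.Ioc 0 N, etaWronskian n - 4 * ∑ n ∈ Finset.Ioc 0 (N / 2), etaWronskian n +
    4 * ∑ n ∈ Finset.Ioc 0 (N / 2 / 2), etaWronskian n +
    2 * (Real.log 2 ^ 2 * ∑ n ∈ Finset.Ioc 0 (N / 2), (eta * eta) n) := by
  have h : gammaAF ^ 2 * etaWronskian =
      etaWronskian - 4 • (atTwo * etaWronskian) + 4 • (atTwo * (atTwo * etaWronskian)) := by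
    simp only [gammaAF, nsmul_eq_mul]; push_cast; ring
  simp only [← gammaAF_pow_mul_zetaWronskian_apply, gammaAF_pow_mul_zetaWronskian, h,
    sub_af_apply, ArithmeticFunction.add_apply, nsmul_af_apply,
    logMulAF_logMulAF_atTwo_mul_apply, Finset.sum_add_distrib, Finset.sum_sub_distrib,
    ← Finset.mul_sum, sum_atTwo_mul]
  push_cast
  rfl

/-- The summatory function of `b` at integers. -/
theorem exists_abs_sum_b_le {ε : ℝ} (h0 : 0 < ε) :
    ∃ K : ℝ, 0 ≤ K ∧ ∀ N : ℕ, |∑ n ∈ Finset.Ioc 0 N, b n| ≤ K * (N : ℝ) ^ (1 / 3 + ε) := by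
  obtain ⟨K, hK0, hK⟩ := exists_abs_sum_etaWronskian_le h0
  obtain ⟨J, hJ0, hJ⟩ := exists_abs_sum_chi_mul_chi_div_le h0
  refine ⟨9 * K + 2 * Real.log 2 ^ 2 * J, by positivity, fun N => ?_⟩
  have hK' : ∀ M ≤ N, |∑ n ∈ Finset.Ioc 0 M, etaWronskian n| ≤ K * (N : ℝ) ^ (1 / 3 + ε) := by
    intro M hM
    rcases Nat.eq_zero_or_pos M with rfl | hpos
    · simp; positivity
    · refine (hK M hpos).trans ?_
      gcongr
  have hJ' : ∀ M ≤ N, |∑ n ∈ Finset.Ioc 0 M, (eta * eta) n| ≤ J * (N : ℝ) ^ (1 / 3 + ε) := by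
    intro M hM
    rcases Nat.eq_zero_or_pos M with rfl | hpos
    · simp; positivity
    · rw [sum_eta_mul_eta]
      refine (hJ M hpos M.sqrt (by rw [sq]; exact Nat.sqrt_le M)).trans ?_
      gcongr
  rw [sum_b]
  have b1 := abs_le.1 (hK' N le_rfl)
  have b2 := abs_le.1 (hK' (N / 2) (by omega))
  have b3 := abs_le.1 (hK' (N / 2 / 2) (by omega))
  have b4 := hJ' (N / 2) (by omega)
  have b5 : |Real.log 2 ^ 2 * ∑ n ∈ Finset.Ioc 0 (N / 2), (eta * eta) n| ≤
      Real.log 2 ^ 2 * (J * (N : ℝ) ^ (1 / 3 + ε)) := by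
    rw [abs_mul, abs_of_nonneg (by positivity)]
    gcongr
  have b5 := abs_le.1 b5
  rw [abs_le]
  constructor <;> linarith [b1.1, b1.2, b2.1, b2.2, b3.1, b3.2, b5.1, b5.2]

lemma B_eq (x : ℝ) : B x = ∑ n ∈ Finset.Ioc 0 ⌊x⌋₊, b n := rfl

theorem B_isBigO {ε : ℝ} (h0 : 0 < ε) : B =O[atTop] fun x : ℝ => x ^ (1 / 3 + ε) := by
  obtain ⟨K, hK0, hK⟩ := exists_abs_sum_b_le h0
  refine IsBigO.of_bound K ?_
  filter_upwards [eventually_ge_atTop 0] with x hx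
  rw [B_eq, Real.norm_eq_abs, Real.norm_of_nonneg (by positivity)]
  refine (hK _).trans ?_
  gcongr
  exact Nat.floor_le hx

/-! ### Convergence from a bound for the summatory function -/

lemma norm_cpow_neg_sub_le {s : ℂ} (hs : 0 < s.re) {n : ℕ} (hn : 1 ≤ n) :
    ‖(n : ℂ) ^ (-s) - ((n + 1 : ℕ) : ℂ) ^ (-s)‖ ≤ ‖s‖ * (n : ℝ) ^ (-s.re - 1) := by
  have hn0 : (0 : ℝ) < n := by exact_mod_cast hn
  have hs0 : -s ≠ 0 := by
    intro h; rw [neg_eq_zero] at h; rw [h] at hs; simp at hs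
  have hderiv : ∀ t ∈ Set.Icc (n : ℝ) (n + 1),
      HasDerivWithinAt (fun t : ℝ => (t : ℂ) ^ (-s)) (-s * (t : ℂ) ^ (-s - 1))
        (Set.Icc (n : ℝ) (n + 1)) t := by
    intro t ht
    exact (hasDerivAt_ofReal_cpow_const (by linarith [ht.1] : t ≠ 0) hs0).hasDerivWithinAt
  have hb : ∀ t ∈ Set.Icc (n : ℝ) (n + 1), ‖-s * (t : ℂ) ^ (-s - 1)‖ ≤
      ‖s‖ * (n : ℝ) ^ (-s.re - 1) := by
    intro t ht
    rw [norm_mul, norm_neg, Complex.norm_cpow_eq_rpow_re_of_pos (by linarith [ht.1])]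
    simp only [Complex.sub_re, Complex.neg_re, Complex.one_re]
    refine mul_le_mul_of_nonneg_left ?_ (norm_nonneg _)
    exact Real.rpow_le_rpow_of_nonpos hn0 ht.1 (by linarith)
  have := (convex_Icc (n : ℝ) (n + 1)).norm_image_sub_le_of_norm_hasDerivWithin_le hderiv hb
    (Set.right_mem_Icc.2 (by linarith)) (Set.left_mem_Icc.2 (by linarith))
  simpa using this

/-- Dirichlet series whose coefficients have summatory function `O(n^θ)` converge to the right of
`θ ≥ 0`. -/
theorem dirichletConverges_of_sum_le {f : ℕ → ℝ} {θ K : ℝ} (hθ : 0 ≤ θ)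
    (h : ∀ N : ℕ, |∑ n ∈ Finset.Ioc 0 N, f n| ≤ K * (N : ℝ) ^ θ) {s : ℂ} (hs : θ < s.re) :
    DirichletConverges (fun n => (f n : ℂ)) s := by
  set F : ℕ → ℝ := fun N => ∑ n ∈ Finset.Ioc 0 N, f n with hF
  have hparts : ∀ N : ℕ, ∑ n ∈ Finset.Icc 1 N, (f n : ℂ) * (n : ℂ) ^ (-s) =
      (F N : ℂ) * (N : ℂ) ^ (-s) +
      ∑ n ∈ Finset.range N, (F n : ℂ) * ((n : ℂ) ^ (-s) - ((n + 1 : ℕ) : ℂ) ^ (-s)) := by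
    intro N
    induction N with
    | zero => simp [hF]
    | succ N ih =>
      have h1 : F (N + 1) = F N + f (N + 1) := by
        simp only [hF]
        rw [← Finset.sum_Ioc_succ_top (Nat.zero_le N)]
      rw [Finset.sum_Icc_succ_top (by omega), ih, Finset.sum_range_succ, h1]
      push_cast
      ring
  have hsum : Summable (fun n : ℕ => (F n : ℂ) * ((n : ℂ) ^ (-s) - ((n + 1 : ℕ) : ℂ) ^ (-s))) := by
    have hS : Summable (fun n : ℕ => K * ‖s‖ * (n : ℝ) ^ (θ - s.re - 1)) :=
      (Real.summable_nat_rpow.2 (by linarith)).mul_left _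
    refine Summable.of_norm_bounded hS fun n => ?_
    rcases Nat.eq_zero_or_pos n with rfl | hn
    · have hF0 : F 0 = 0 := by simp [hF]
      rw [hF0, Complex.ofReal_zero, zero_mul, norm_zero, Nat.cast_zero,
        Real.zero_rpow (by linarith), mul_zero]
    have hn0 : (0 : ℝ) < n := by exact_mod_cast hn
    rw [norm_mul, Complex.norm_real, Real.norm_eq_abs]
    calc _ ≤ (K * (n : ℝ) ^ θ) * (‖s‖ * (n : ℝ) ^ (-s.re - 1)) :=
          mul_le_mul (h n) (norm_cpow_neg_sub_le (by linarith) hn) (norm_nonneg _)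
            ((abs_nonneg _).trans (h n))
      _ = K * ‖s‖ * ((n : ℝ) ^ θ * (n : ℝ) ^ (-s.re - 1)) := by ring
      _ = _ := by rw [← Real.rpow_add hn0]; congr 2; ring
  have hzero : Tendsto (fun N : ℕ => (F N : ℂ) * (N : ℂ) ^ (-s)) atTop (𝓝 0) := by
    have hlim : Tendsto (fun N : ℕ => K * (N : ℝ) ^ (-(s.re - θ))) atTop (𝓝 0) := by
      have := ((tendsto_rpow_neg_atTop (by linarith : 0 < s.re - θ)).comp
        tendsto_natCast_atTop_atTop).const_mul K
      rwa [mul_zero] at this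
    refine squeeze_zero_norm' ?_ hlim
    filter_upwards [eventually_ge_atTop 1] with N hN
    have hN0 : (0 : ℝ) < N := by exact_mod_cast hN
    rw [norm_mul, Complex.norm_real, Real.norm_eq_abs,
      Complex.norm_natCast_cpow_of_pos hN, Complex.neg_re]
    calc _ ≤ (K * (N : ℝ) ^ θ) * (N : ℝ) ^ (-s.re) :=
          mul_le_mul_of_nonneg_right (h N) (by positivity)
      _ = _ := by rw [mul_assoc, ← Real.rpow_add hN0]; congr 2; ring
  refine ⟨_, Tendsto.congr (fun N => (hparts N).symm) (hzero.add hsum.hasSum.tendsto_sum_nat)⟩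

theorem abscissaOfConv_b_le :
    abscissaOfConv (fun n => (b n : ℂ)) ≤ (((1 : ℝ) / 3 : ℝ) : EReal) := by
  refine sInf_le fun s hs => ?_
  have hs' : (1 : ℝ) / 3 < s.re := EReal.coe_lt_coe_iff.1 hs
  obtain ⟨K, _, hK⟩ := exists_abs_sum_b_le (ε := (s.re - 1 / 3) / 2) (by linarith)
  exact dirichletConverges_of_sum_le (by linarith) hK (by linarith)

/-! ### The Dirichlet series of `φ` -/

lemma LSeriesHasSum_af_mul {f g : ArithmeticFunction ℝ} {s A C : ℂ}
    (hf : LSeriesHasSum (fun n => (f n : ℂ)) s A) (hg : LSeriesHasSum (fun n => (g n : ℂ)) s C) :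
    LSeriesHasSum (fun n => ((f * g) n : ℂ)) s (A * C) := by
  have h := hf.convolution hg
  rwa [LSeries.convolution_def, show (fun n : ℕ => ∑ p ∈ n.divisorsAntidiagonal,
    (f p.1 : ℂ) * (g p.2 : ℂ)) = fun n => ((f * g) n : ℂ) from funext fun n => by
      rw [ArithmeticFunction.mul_apply]; push_cast; rfl] at h

lemma LSeriesHasSum_af_sub {f g : ArithmeticFunction ℝ} {s A C : ℂ}
    (hf : LSeriesHasSum (fun n => (f n : ℂ)) s A) (hg : LSeriesHasSum (fun n => (g n : ℂ)) s C) :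
    LSeriesHasSum (fun n => ((f - g) n : ℂ)) s (A - C) := by
  have h := hf.sub hg
  convert h using 1
  ext n
  simp [sub_af_apply]

lemma LSeriesHasSum_af_single {f : ArithmeticFunction ℝ} {k : ℕ} (hk : k ≠ 0)
    (hf : ∀ n, f n = if n = k then 1 else 0) (s : ℂ) :
    LSeriesHasSum (fun n => (f n : ℂ)) s ((k : ℂ) ^ (-s)) := by
  have h := hasSum_single (f := LSeries.term (fun n => (f n : ℂ)) s) k (fun n hn => by
    rw [LSeries.term_def, hf, if_neg hn]; simp)
  rw [LSeries.term_of_ne_zero hk, hf, if_pos rfl, Complex.ofReal_one, one_div,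
    ← Complex.cpow_neg] at h
  exact h

lemma LSeriesHasSum_gammaAF (s : ℂ) :
    LSeriesHasSum (fun n => (gammaAF n : ℂ)) s (1 - (2 : ℂ) ^ (1 - s)) := by
  have h1 := LSeriesHasSum_af_single (f := 1) one_ne_zero
    (fun n => ArithmeticFunction.one_apply) s
  have h2 := LSeriesHasSum_af_single (f := atTwo) two_ne_zero atTwo_apply s
  have h := LSeriesHasSum_af_sub (LSeriesHasSum_af_sub h1 h2) h2
  rw [sub_sub] at h
  have e1 : (((1 : ℕ) : ℂ) ^ (-s) - ((2 : ℕ) : ℂ) ^ (-s) - ((2 : ℕ) : ℂ) ^ (-s)) =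
      1 - (2 : ℂ) ^ (1 - s) := by
    rw [sub_eq_add_neg 1 s, Complex.cpow_add _ _ two_ne_zero, Complex.cpow_one]
    push_cast
    rw [Complex.one_cpow]
    ring
  rwa [e1] at h

/-- Termwise differentiation of the zeta series. -/
lemma LSeriesHasSum_logMul_iterate {s : ℂ} (hs : 1 < s.re) (m : ℕ) :
    LSeriesHasSum (LSeries.logMul^[m] 1) s ((-1) ^ m * iteratedDeriv m riemannZeta s) := by
  have habs : LSeries.abscissaOfAbsConv 1 < s.re := by
    rw [LSeries.abscissaOfAbsConv_one]; exact_mod_cast hs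
  have hsum : LSeriesSummable (LSeries.logMul^[m] 1) s :=
    LSeriesSummable_of_abscissaOfAbsConv_lt_re (by rwa [LSeries.absicssaOfAbsConv_logPowMul])
  have hd := LSeries_iteratedDeriv m habs
  have hev : LSeries 1 =ᶠ[𝓝 s] riemannZeta := by
    filter_upwards [(isOpen_lt continuous_const Complex.continuous_re).mem_nhds hs] with z hz
    exact LSeries_one_eq_riemannZeta hz
  rw [hev.iteratedDeriv_eq] at hd
  rw [hd, ← mul_assoc, ← mul_pow, neg_one_mul, neg_neg, one_pow, one_mul]
  exact hsum.LSeriesHasSum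

lemma LSeriesHasSum_b {s : ℂ} (hs : 1 < s.re) :
    LSeriesHasSum (fun n => (b n : ℂ)) s (phi s) := by
  have z0 : LSeriesHasSum (fun n => (zetaAF n : ℂ)) s (riemannZeta s) := by
    refine (LSeriesHasSum_congr s _ fun {n} hn => ?_).1 (LSeriesHasSum_one hs)
    rw [zetaAF_apply hn]; simp
  have z1 : LSeriesHasSum (fun n => (logMulAF zetaAF n : ℂ)) s (-deriv riemannZeta s) := by
    have h := LSeriesHasSum_logMul_iterate hs 1
    rw [iteratedDeriv_one, pow_one, neg_one_mul] at h
    refine (LSeriesHasSum_congr s _ fun {n} hn => ?_).1 h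
    rw [logMulAF_apply, zetaAF_apply hn]
    simp [LSeries.logMul, Complex.natCast_log]
  have z2 : LSeriesHasSum (fun n => (logMulAF (logMulAF zetaAF) n : ℂ)) s
      (iteratedDeriv 2 riemannZeta s) := by
    have h := LSeriesHasSum_logMul_iterate hs 2
    rw [neg_one_sq, one_mul] at h
    refine (LSeriesHasSum_congr s _ fun {n} hn => ?_).1 h
    rw [logMulAF_apply, logMulAF_apply, zetaAF_apply hn]
    simp [LSeries.logMul, Complex.natCast_log]
  have g := LSeriesHasSum_gammaAF s
  have h := LSeriesHasSum_af_mul g (LSeriesHasSum_af_mul g (LSeriesHasSum_af_mul g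
    (LSeriesHasSum_af_mul g (LSeriesHasSum_af_sub (LSeriesHasSum_af_mul z0 z2)
      (LSeriesHasSum_af_mul z1 z1)))))
  convert h using 1
  · ext n
    rw [← gammaAF_pow_mul_zetaWronskian_apply, zetaWronskian]
    congr 2
    ring
  · rw [phi, nu]; ring

end ZetaLog

theorem mainTheorem5 :
    (∀ s : ℂ, 1 < s.re → LSeriesHasSum (fun n => (ZetaLog.b n : ℂ)) s (ZetaLog.phi s)) ∧
    (∀ ε : ℝ, 0 < ε → ZetaLog.B =O[atTop] fun x : ℝ => x ^ (1 / 3 + ε)) ∧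
    ZetaLog.abscissaOfConv (fun n => (ZetaLog.b n : ℂ)) ≤ (((1 : ℝ) / 3 : ℝ) : EReal) :=
  ⟨fun _ hs => ZetaLog.LSeriesHasSum_b hs, fun _ hε => ZetaLog.B_isBigO hε,
    ZetaLog.abscissaOfConv_b_le⟩
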